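/- Setting. Let $k,d\ge 1$, $\sigma>0$, and let $w^\star\in\mathbb R^d$ be a unit vector. Write $x\in\mathbb R^{kd}$ as $x=(x^{(1)},\dots,x^{(k)})$ with patches $x^{(i)}\in\mathbb R^d$, and let $\mu_i\in\mathbb R^{kd}$ have $w^\star$ in patch $i$ and zeros elsewhere. $\mathrm{DSD}$ is the law of $(x,y)$ where $i\sim\mathrm{Unif}\{1,\dots,k\}$ and $y\sim\mathrm{Unif}\{-1,1\}$ are independent and $x\mid(y,i)\sim\mathcal N(y\mu_i,\sigma^2 I_{kd})$. With $\phi_b(t)=\max(t-b,0)-\max(-t-b,0)$, the LCN with parameters $v=[w_1,\dots,w_k,b]\in\mathcal W=\mathbb R^{kd}\times\mathbb R_{\ge 0}$ is $M[v](x)=\sum_{i=1}^k\phi_b(w_i^{T}x^{(i)})$; networks of the class have $\|w_i\|\le 1$ for all $i$. An iterative algorithm on $n$ samples draws $v^0\sim W$ from a probability distribution $W$ on $\mathcal W$, sets $v^t=F^t(v^{t-1},S^n)$ for $t=1,\dots,T$ with measurable update functions $F^t$ that map $\mathcal W$ to itself, and returns $M[v^T]$; it trains LCNs if the returned parameters satisfy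 $\|w_i\|\le 1$ for all $i$ (for almost every $v^0$ and every data set). For a set $\mathcal U$ of orthogonal $kd\times kd$ matrices it is $\mathcal U$-equivariant if there is a set $\mathcal V$ of orthogonal $(kd+1)\times(kd+1)$ matrices mapping $\mathcal W$ to itself such that (1),(2) for every $U\in\mathcal U$ there is $V\in\mathcal V$ with $M[v](x)=M[Vv](Ux)$ for all $x$ and $v\in\mathcal W$, and $VF^t(v,\{(x_s,y_s)\})=F^t(Vv,\{(Ux_s,y_s)\})$ for all $t\le T$, all $v\in\mathcal W$ and all data sets; and (3) $Vv^0\overset{d}{=}v^0$ for all $V\in\mathcal V$ if $v^0\sim W$. Let $\mathcal U$ be the group of all finite products of elements of $\mathcal U_1\cup\mathcal U_2$, where $\mathcal U_1=\{\mathrm{Block}(U_1,\dots,U_k): U_i\in O(d)\}$ and $\mathcal U_2$ consists of the $kd\times kd$ permutation matrices that permute the $k$ patches and keep the order inside each patch. For algorithms $\bar\theta=(\bar\theta_n)_{n}$, one for each number $n$ of samples, let $n_\delta(\bar\theta)\in\mathbb N\cup\{\infty\}$ be the least $n$ for which the expected risk $\mathbb E\big[\mathbb E_{(x,y)\sim\mathrm{DSD}}(M[v^T](x)-y)^2\big]$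 is at most $\delta$, the outer expectation being over $S^n\sim\mathrm{DSD}^n$ and $v^0\sim W$. Theorem. There are absolute constants $c,C>0$ and $k_0,d_0\in\mathbb N$ such that for all $k\ge k_0$, $d\ge d_0$, $\sigma>0$, all unit vectors $w^\star\in\mathbb R^d$, and all $\mathcal U$-equivariant iterative algorithms $\bar\theta_n$ that train LCNs, with $\delta=0.25\cdot10^{-2}$, $$n_\delta(\bar\theta)\ \ge\ c\,\max(\sigma^2kd,\;k),$$ and if moreover $\sigma^2 d\ge C$ (that is, if $d$ is large enough for the given noise level), then $$n_\delta(\bar\theta)\ \ge\ \max(c\,\sigma^2kd,\;40k).$$ -/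

import Mathlib

open MeasureTheory ProbabilityTheory
open scoped ENNReal NNReal Matrix

namespace LCNLower

noncomputable section

/-! ### The data distribution

Inputs live in `ℝ^{kd}`, with coordinates indexed by `Fin k × Fin d`: the pair `(i, j)` is the
`j`-th coordinate of the `i`-th patch, i.e. it stands for coordinate number `i * d + j`
(counting from `0`), see `idx`. -/

/-- The position of a coordinate in `ℝ^{kd}`, `(i, j) ↦ i * d + j`, all counted from `0`. -/
def idx {k d : ℕ} (p : Fin k × Fin d) : ℕ := (finProdFinEquiv p : Fin (k * d))

/-- The mean vector `μ_t`: the signal `ws` in patch `t`, zero in all other patches. -/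
def meanVec {k d : ℕ} (ws : EuclideanSpace ℝ (Fin d)) (t : Fin k) : Fin k × Fin d → ℝ :=
  fun p => if p.1 = t then ws p.2 else 0

/-- The isotropic Gaussian `N(μ, σ² I)` on `ℝ^ι`. -/
def isoGaussian {ι : Type} [Fintype ι] (μ : ι → ℝ) (σ : ℝ) : Measure (ι → ℝ) :=
  Measure.pi fun p => gaussianReal (μ p) (NNReal.mk (σ ^ 2) (sq_nonneg σ))

/-- The static signal distribution `SSD_t`: `y` is uniform on `{1, -1}` and
`x | y ∼ N(y μ_t, σ² I)`. -/
def SSD {k d : ℕ} (ws : EuclideanSpace ℝ (Fin d)) (σ : ℝ) (t : Fin k) :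
    Measure ((Fin k × Fin d → ℝ) × ℝ) :=
  (2 : ℝ≥0∞)⁻¹ • ((isoGaussian (meanVec ws t) σ).prod (Measure.dirac 1)
    + (isoGaussian (-meanVec ws t) σ).prod (Measure.dirac (-1)))

/-- The dynamic signal distribution `DSD`: the index `t` is uniform on the `k` patches, and
`(x, y) | t ∼ SSD_t`. -/
def DSD (k d : ℕ) (ws : EuclideanSpace ℝ (Fin d)) (σ : ℝ) :
    Measure ((Fin k × Fin d → ℝ) × ℝ) :=
  (k : ℝ≥0∞)⁻¹ • ∑ t : Fin k, SSD ws σ t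

/-! ### Locally connected networks -/

/-- The activation `φ_b(x) = ReLU(x - b) - ReLU(-x - b)`. -/
def lsa (b x : ℝ) : ℝ := max (x - b) 0 - max (-x - b) 0

/-- The coordinates of the parameter vector `[w_1, …, w_k, b]` of an LCN. -/
abbrev ParamIdx (k d : ℕ) : Type := (Fin k × Fin d) ⊕ Unit

/-- The weight vector `w_i` of the `i`-th hidden node. -/
def weight {k d : ℕ} (v : ParamIdx k d → ℝ) (i : Fin k) : EuclideanSpace ℝ (Fin d) :=
  WithLp.toLp 2 fun j => v (Sum.inl (i, j))

/-- The bias `b`. -/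
def bias {k d : ℕ} (v : ParamIdx k d → ℝ) : ℝ := v (Sum.inr ())

/-- The parameter set `ℝ^{kd} × ℝ_+`. -/
def lcnParams (k d : ℕ) : Set (ParamIdx k d → ℝ) := {v | 0 ≤ bias v}

/-- The LCN `x ↦ ∑ i, φ_b(w_iᵀ x^{(i)})`. -/
def lcn {k d : ℕ} (v : ParamIdx k d → ℝ) (x : Fin k × Fin d → ℝ) : ℝ :=
  ∑ i : Fin k, lsa (bias v) (∑ j : Fin d, weight v i j * x (i, j))

/-! ### Iterative algorithms, equivariance, risk and sample complexity -/

/-- An iterative algorithm on `n` samples from `ℝ^ι × ℝ`, with parameter set `W ⊆ ℝ^κ`: the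
parameters are drawn from `init` and then updated `T` times; `update t` is the update function
number `t + 1`. (Update functions are total functions on `ℝ^κ` which map `W` to itself; their
values outside of `W` play no role.) -/
structure IterAlgorithm (ι κ : Type) [Fintype ι] [Fintype κ] (W : Set (κ → ℝ)) (n : ℕ) where
  T : ℕ
  update : ℕ → (κ → ℝ) → (Fin n → (ι → ℝ) × ℝ) → (κ → ℝ)
  init : Measure (κ → ℝ)
  isProb_init : IsProbabilityMeasure init
  init_mem : ∀ᵐ v ∂init, v ∈ W
  update_mem : ∀ t < T, ∀ v ∈ W, ∀ S, update t v S ∈ W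
  measurable_update : ∀ t < T, Measurable fun q : (κ → ℝ) × (Fin n → (ι → ℝ) × ℝ) =>
    update t q.1 q.2

namespace IterAlgorithm

variable {ι κ : Type} [Fintype ι] [Fintype κ] {W : Set (κ → ℝ)} {n : ℕ}

/-- The parameters after `t` iterations, started from `v`, on the data set `S`. -/
def iterate (A : IterAlgorithm ι κ W n) (v : κ → ℝ) (S : Fin n → (ι → ℝ) × ℝ) :
    ℕ → (κ → ℝ)
  | 0 => v
  | t + 1 => A.update t (A.iterate v S t) S

/-- The parameters that the algorithm returns. -/
def output (A : IterAlgorithm ι κ W n) (v : κ → ℝ) (S : Fin n → (ι → ℝ) × ℝ) : κ → ℝ :=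
  A.iterate v S A.T

/-- The data set `{(U x_s, y_s)}`. -/
def transform (U : Matrix ι ι ℝ) (S : Fin n → (ι → ℝ) × ℝ) : Fin n → (ι → ℝ) × ℝ :=
  fun s => (U *ᵥ (S s).1, (S s).2)

/-- `𝒰`-equivariance of an iterative algorithm for the model `M`. The clause that `V` maps `W` to
itself is what makes the model and the update functions applicable to `V w`. -/
def IsEquivariant [DecidableEq κ] (A : IterAlgorithm ι κ W n)
    (M : (κ → ℝ) → (ι → ℝ) → ℝ) (𝒰 : Set (Matrix ι ι ℝ)) : Prop :=
  ∃ 𝒱 : Set (Matrix κ κ ℝ),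
    (∀ V ∈ 𝒱, V ∈ Matrix.orthogonalGroup κ ℝ ∧ Set.MapsTo (fun w => V *ᵥ w) W W) ∧
    (∀ U ∈ 𝒰, ∃ V ∈ 𝒱,
      (∀ x, ∀ w ∈ W, M w x = M (V *ᵥ w) (U *ᵥ x)) ∧
      (∀ S : Fin n → (ι → ℝ) × ℝ, ∀ t < A.T, ∀ w ∈ W,
        V *ᵥ A.update t w S = A.update t (V *ᵥ w) (transform U S))) ∧
    (∀ V ∈ 𝒱, A.init.map (fun w => V *ᵥ w) = A.init)

end IterAlgorithm

/-- The risk `E_{(x, y) ∼ P} (f(x) - y)²`, as an element of `[0, ∞]`. -/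
def risk {ι : Type} (f : (ι → ℝ) → ℝ) (P : Measure ((ι → ℝ) × ℝ)) : ℝ≥0∞ :=
  ∫⁻ z, ENNReal.ofReal ((f z.1 - z.2) ^ 2) ∂P

/-- The expected risk of the trained model, over the initialization and over `n` i.i.d. samples
from `P`. -/
def expectedRisk {ι κ : Type} [Fintype ι] [Fintype κ] {W : Set (κ → ℝ)} {n : ℕ}
    (A : IterAlgorithm ι κ W n) (M : (κ → ℝ) → (ι → ℝ) → ℝ)
    (P : Measure ((ι → ℝ) × ℝ)) : ℝ≥0∞ :=
  ∫⁻ v, ∫⁻ S, risk (M (A.output v S)) P ∂(Measure.pi fun _ : Fin n => P) ∂A.init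

/-- The `δ`-sample complexity: the least number `n` of samples for which the expected risk is at
most `δ` (and `⊤` if there is none). -/
def sampleComplexity {ι κ : Type} [Fintype ι] [Fintype κ] {W : Set (κ → ℝ)}
    (A : (n : ℕ) → IterAlgorithm ι κ W n) (M : (κ → ℝ) → (ι → ℝ) → ℝ)
    (P : Measure ((ι → ℝ) × ℝ)) (δ : ℝ) : ℕ∞ :=
  ⨅ (n : ℕ) (_ : expectedRisk (A n) M P ≤ ENNReal.ofReal δ), (n : ℕ∞)

/-- The algorithm trains networks of the class, whose nodes obey `‖w_i‖ ≤ 1`: the network that it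
returns has this property. (The iterates, the initial one included, need not.) -/
def ReturnsUnitWeights {k d n : ℕ}
    (A : IterAlgorithm (Fin k × Fin d) (ParamIdx k d) (lcnParams k d) n) : Prop :=
  ∀ᵐ v ∂A.init, ∀ S, ∀ i, ‖weight (A.output v S) i‖ ≤ 1

/-! ### The group -/

/-- `𝒰₁`: the block diagonal matrices with one orthogonal `d × d` block per patch. -/
def blockOrthogonal (k d : ℕ) : Set (Matrix (Fin k × Fin d) (Fin k × Fin d) ℝ) :=
  {U | ∃ B : Fin k → Matrix (Fin d) (Fin d) ℝ, (∀ i, B i ∈ Matrix.orthogonalGroup (Fin d) ℝ) ∧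
    U = Matrix.of fun p q => if p.1 = q.1 then B p.1 p.2 q.2 else 0}

/-- `𝒰₂`: the permutation matrices, `U e_p = e_{τ p}`, for which
`idx (U e_{(i, j)}) = idx (U e_{(i, 0)}) + j`; they permute the patches and keep each of them
in order. -/
def patchPermutations (k d : ℕ) : Set (Matrix (Fin k × Fin d) (Fin k × Fin d) ℝ) :=
  {U | ∃ τ : Equiv.Perm (Fin k × Fin d),
    (U = Matrix.of fun q p => if q = τ p then 1 else 0) ∧
    ∀ (i : Fin k) (j j₀ : Fin d), (j₀ : ℕ) = 0 → idx (τ (i, j)) = idx (τ (i, j₀)) + j}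

/-- `𝒰 = 𝒰₁ ⋆ 𝒰₂`: all finite products of elements of `𝒰₁ ∪ 𝒰₂`. -/
def patchGroup (k d : ℕ) : Set (Matrix (Fin k × Fin d) (Fin k × Fin d) ℝ) :=
  (Submonoid.closure (blockOrthogonal k d ∪ patchPermutations k d) :
    Submonoid (Matrix (Fin k × Fin d) (Fin k × Fin d) ℝ))

end

end LCNLower

namespace LCNLower

/-! ### Two-point bounds through densities -/

/-! Equivariance turns the problem into a Bayesian one. A block diagonal matrix can rotate `w⋆` to
any prescribed unit vector `u_t` in each patch separately, and the expected risk does not change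
when the data distribution is moved by such a matrix (`expectedRisk_map_eq`,
`expectedRisk_signedMixture_eq`). Hence the algorithm has the same expected risk on every mixture
whose `t`-th component carries its own signal `u_t`, and this risk equals its average over the
`2^(kd)` choices `u_t = (±1, …, ±1)/√d`. The learner effectively has to find `kd` unknown signs.

Small risk forces correlation with these signs. In one patch the signal moves the network output by
at most the positive part of `⟨w_t, u_t⟩`, which gives the bound `1/4 - (∑ t, ⟨w_t, u_t⟩)/(2k)`
(`le_risk_signedMixture`). It is affine in the signals, so only the mean of the returned weights
matters when averaging.

Correlation is limited by an Assouad argument. Flipping one sign changes only one of the `k` mixture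
components, and there only one coordinate of the mean, of size `1/√d`. The Hellinger affinity of the
two one-sample laws is therefore at least `1 - (1 - exp(-1/(2σ²d)))/k`, and for `n` samples at least
`1 - n(1 - exp(-1/(2σ²d)))/k` (`integral_sub_integral_flip_le`). The two-point inequality keeps the
second moments of the weights; since these sum to at most `1` in each patch, summing over all
coordinates loses nothing in the order of magnitude (`sum_integral_sign_le`). Finally `1 - exp(-x) ≤
min(1, x)` produces both scales `k` and `σ²kd`. -/

lemma pi_withDensity_ofReal {ι X : Type*} [Fintype ι] [MeasurableSpace X] (ν : ι → Measure X)
    [∀ i, SigmaFinite (ν i)] (p : ι → X → ℝ) (hp : ∀ i x, 0 ≤ p i x)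
    (hi : ∀ i, Integrable (p i) (ν i)) :
    Measure.pi (fun i => (ν i).withDensity fun x => ENNReal.ofReal (p i x)) =
      (Measure.pi ν).withDensity fun x => ENNReal.ofReal (∏ i, p i (x i)) := by
  have hfin : ∀ i, IsFiniteMeasure ((ν i).withDensity fun x => ENNReal.ofReal (p i x)) :=
    fun i => isFiniteMeasure_withDensity_ofReal (hi i).2
  refine Measure.pi_eq fun s hs => ?_
  have hms : MeasurableSet (Set.univ.pi s) := MeasurableSet.univ_pi hs
  rw [withDensity_apply _ hms, ← lintegral_indicator hms]
  -- The indicator of a box is a product over the coordinates, so Fubini applies factor by factor.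
  have h1 : ∀ x : ι → X, (Set.univ.pi s).indicator
      (fun x => ENNReal.ofReal (∏ i, p i (x i))) x =
      ENNReal.ofReal (∏ i, (s i).indicator (p i) (x i)) := by
    intro x
    by_cases hx : x ∈ Set.univ.pi s
    · rw [Set.indicator_of_mem hx]
      congr 1
      refine Finset.prod_congr rfl fun i _ => ?_
      rw [Set.indicator_of_mem (hx i (Set.mem_univ i))]
    · rw [Set.indicator_of_notMem hx]
      simp only [Set.mem_pi, Set.mem_univ, true_implies, not_forall] at hx
      obtain ⟨i, hi⟩ := hx
      rw [Finset.prod_eq_zero (Finset.mem_univ i) (Set.indicator_of_notMem hi _)]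
      simp
  have hi' : ∀ i, Integrable ((s i).indicator (p i)) (ν i) := fun i => (hi i).indicator (hs i)
  have hp' : ∀ i x, 0 ≤ (s i).indicator (p i) x := fun i x =>
    Set.indicator_nonneg (fun x _ => hp i x) x
  simp_rw [h1]
  rw [← ofReal_integral_eq_lintegral_ofReal (Integrable.fintype_prod hi')
    (Filter.Eventually.of_forall fun x => Finset.prod_nonneg fun i _ => hp' i _),
    integral_fintype_prod_eq_prod,
    ENNReal.ofReal_prod_of_nonneg fun i _ => integral_nonneg (hp' i)]
  refine Finset.prod_congr rfl fun i _ => ?_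
  rw [withDensity_apply _ (hs i), integral_indicator (hs i),
    ofReal_integral_eq_lintegral_ofReal (hi i).integrableOn
      (Filter.Eventually.of_forall (hp i))]

/-- With `P = a²` and `Q = b²`, factor `h(P - Q) = h(a + b)(a - b)` and apply the weighted
arithmetic-geometric mean inequality; then `(a + b)² ≤ 2(a² + b²)` and `s ≤ ab`. Keeping `h²`
instead of a uniform bound on `h` is what later allows the second moments to be summed over
coordinates. -/
lemma mul_sub_le_of_sq_le {P Q s l h : ℝ} (hP : 0 ≤ P) (hQ : 0 ≤ Q)
    (hs : s ^ 2 ≤ P * Q) (hl : 0 < l) :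
    h * (P - Q) ≤ l * (P + Q - 2 * s) / 2 + h ^ 2 * (P + Q) / l := by
  obtain ⟨a, ha, rfl⟩ : ∃ a, 0 ≤ a ∧ P = a ^ 2 := ⟨√P, Real.sqrt_nonneg _, (Real.sq_sqrt hP).symm⟩
  obtain ⟨b, hb, rfl⟩ : ∃ b, 0 ≤ b ∧ Q = b ^ 2 := ⟨√Q, Real.sqrt_nonneg _, (Real.sq_sqrt hQ).symm⟩
  have hab : s ≤ a * b := by
    refine le_of_sq_le_sq ?_ (mul_nonneg ha hb)
    linarith [mul_pow a b 2]
  have h1 : h * (a ^ 2 - b ^ 2) ≤ l * (a - b) ^ 2 / 2 + h ^ 2 * (a + b) ^ 2 / (2 * l) := by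
    have : l * (a - b) ^ 2 / 2 + h ^ 2 * (a + b) ^ 2 / (2 * l) - h * (a ^ 2 - b ^ 2) =
        (l * (a - b) - h * (a + b)) ^ 2 / (2 * l) := by
      field_simp
      ring
    have : 0 ≤ (l * (a - b) - h * (a + b)) ^ 2 / (2 * l) := by positivity
    linarith
  have h2 : h ^ 2 * (a + b) ^ 2 / (2 * l) ≤ h ^ 2 * (a ^ 2 + b ^ 2) / l := by
    have : h ^ 2 * (a ^ 2 + b ^ 2) / l - h ^ 2 * (a + b) ^ 2 / (2 * l) =
        h ^ 2 * (a - b) ^ 2 / (2 * l) := by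
      field_simp
      ring
    have : 0 ≤ h ^ 2 * (a - b) ^ 2 / (2 * l) := by positivity
    linarith
  have h3 : l * (a - b) ^ 2 / 2 ≤ l * (a ^ 2 + b ^ 2 - 2 * s) / 2 := by
    have := mul_le_mul_of_nonneg_left hab hl.le
    nlinarith
  linarith

/-- If `s ^ 2 ≤ p q` for two probability densities, then the means of a bounded function under the
`n`-fold products are close when `∫ s` is close to `1`. -/
lemma integral_pi_sub_integral_pi_le {X : Type*} [MeasurableSpace X] {ν : Measure X}
    [SigmaFinite ν] {p q s : X → ℝ} (hp : ∀ x, 0 ≤ p x) (hq : ∀ x, 0 ≤ q x)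
    (hsq : ∀ x, s x ^ 2 ≤ p x * q x)
    (hpi : Integrable p ν) (hqi : Integrable q ν) (hsi : Integrable s ν)
    (hp1 : ∫ x, p x ∂ν = 1) (hq1 : ∫ x, q x ∂ν = 1) (n : ℕ)
    {h : (Fin n → X) → ℝ} (hm : Measurable h) (hb : ∀ x, |h x| ≤ 1) {l : ℝ} (hl : 0 < l) :
    ∫ x, h x ∂(Measure.pi fun _ => ν.withDensity fun x => ENNReal.ofReal (p x)) -
      ∫ x, h x ∂(Measure.pi fun _ => ν.withDensity fun x => ENNReal.ofReal (q x)) ≤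
    l * (1 - (∫ x, s x ∂ν) ^ n) +
      (∫ x, h x ^ 2 ∂(Measure.pi fun _ => ν.withDensity fun x => ENNReal.ofReal (p x)) +
        ∫ x, h x ^ 2 ∂(Measure.pi fun _ => ν.withDensity fun x => ENNReal.ofReal (q x))) / l := by
  have key : ∀ r : X → ℝ, (∀ x, 0 ≤ r x) → Integrable r ν → ∀ g : (Fin n → X) → ℝ,
      ∫ x, g x ∂(Measure.pi fun _ => ν.withDensity fun x => ENNReal.ofReal (r x)) =
        ∫ x, g x * ∏ i, r (x i) ∂(Measure.pi fun _ : Fin n => ν) := by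
    intro r hr hri g
    have hri' : Integrable (fun x : Fin n → X => ∏ i, r (x i)) (Measure.pi fun _ => ν) :=
      Integrable.fintype_prod fun _ => hri
    rw [pi_withDensity_ofReal (fun _ => ν) (fun _ => r) (fun _ => hr) (fun _ => hri),
      integral_withDensity_eq_integral_toReal_smul₀ hri'.aemeasurable.ennreal_ofReal
        (Filter.Eventually.of_forall fun _ => ENNReal.ofReal_lt_top)]
    refine integral_congr_ae (Filter.Eventually.of_forall fun x => ?_)
    simp only [smul_eq_mul]
    rw [ENNReal.toReal_ofReal (Finset.prod_nonneg fun i _ => hr _), mul_comm]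
  have hb2 : ∀ x, |h x ^ 2| ≤ 1 := fun x => by
    rw [abs_pow]
    exact pow_le_one₀ (abs_nonneg _) (hb x)
  have bd : ∀ r : X → ℝ, Integrable r ν → ∀ g : (Fin n → X) → ℝ, Measurable g →
      (∀ x, |g x| ≤ 1) →
      Integrable (fun x => g x * ∏ i, r (x i)) (Measure.pi fun _ : Fin n => ν) := by
    intro r hri g hg hgb
    exact (Integrable.fintype_prod (f := fun _ : Fin n => r) fun _ => hri).bdd_mul
      hg.aestronglyMeasurable (Filter.Eventually.of_forall hgb)
  rw [key p hp hpi, key q hq hqi, key p hp hpi, key q hq hqi]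
  have ip := bd p hpi h hm hb
  have iq := bd q hqi h hm hb
  have ip2 := bd p hpi _ (hm.pow_const 2) hb2
  have iq2 := bd q hqi _ (hm.pow_const 2) hb2
  have jp : Integrable (fun x : Fin n → X => ∏ i, p (x i)) (Measure.pi fun _ => ν) :=
    Integrable.fintype_prod fun _ => hpi
  have jq : Integrable (fun x : Fin n → X => ∏ i, q (x i)) (Measure.pi fun _ => ν) :=
    Integrable.fintype_prod fun _ => hqi
  have js : Integrable (fun x : Fin n → X => ∏ i, s (x i)) (Measure.pi fun _ => ν) :=
    Integrable.fintype_prod fun _ => hsi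
  have e : ∀ r : X → ℝ, ∫ x : Fin n → X, ∏ i, r (x i) ∂(Measure.pi fun _ => ν) =
      (∫ x, r x ∂ν) ^ n := fun r => by
    rw [integral_fintype_prod_eq_pow, Fintype.card_fin]
  have hle : ∫ x, (h x * ∏ i, p (x i) - h x * ∏ i, q (x i)) ∂(Measure.pi fun _ : Fin n => ν) ≤
      ∫ x, ((l / 2) * (∏ i, p (x i) + ∏ i, q (x i) - 2 * ∏ i, s (x i)) +
        l⁻¹ * (h x ^ 2 * ∏ i, p (x i) + h x ^ 2 * ∏ i, q (x i)))
        ∂(Measure.pi fun _ : Fin n => ν) := by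
    refine integral_mono (ip.sub iq)
      ((((jp.add jq).sub (js.const_mul 2)).const_mul _).add ((ip2.add iq2).const_mul _))
      fun x => ?_
    have := mul_sub_le_of_sq_le (P := ∏ i, p (x i)) (Q := ∏ i, q (x i)) (s := ∏ i, s (x i))
      (h := h x) (l := l) (Finset.prod_nonneg fun i _ => hp _)
      (Finset.prod_nonneg fun i _ => hq _) (by
        rw [← Finset.prod_pow, ← Finset.prod_mul_distrib]
        exact Finset.prod_le_prod (fun i _ => sq_nonneg _) fun i _ => hsq _) hl
    calc _ = h x * (∏ i, p (x i) - ∏ i, q (x i)) := by ring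
      _ ≤ _ := this
      _ = _ := by rw [div_eq_mul_inv _ l]; ring
  have i1 : Integrable (fun x : Fin n → X => ∏ i, p (x i) + ∏ i, q (x i)) (Measure.pi fun _ => ν) :=
    jp.add jq
  have i2 : Integrable (fun x : Fin n → X => ∏ i, p (x i) + ∏ i, q (x i) - 2 * ∏ i, s (x i))
    (Measure.pi fun _ => ν) := i1.sub (js.const_mul 2)
  have i3 : Integrable (fun x : Fin n → X => h x ^ 2 * ∏ i, p (x i) + h x ^ 2 * ∏ i, q (x i))
    (Measure.pi fun _ => ν) := ip2.add iq2
  rw [integral_sub ip iq, integral_add (i2.const_mul _) (i3.const_mul _), integral_const_mul,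
    integral_const_mul,
    integral_sub i1 (js.const_mul 2), integral_add jp jq, integral_add ip2 iq2,
    integral_const_mul, e, e, e, hp1, hq1] at hle
  refine hle.trans (le_of_eq ?_)
  rw [div_eq_mul_inv _ l]
  ring

/-! ### Densities of isotropic Gaussians -/

section Gaussian

variable {ι : Type} [Fintype ι]

/-- The density of the isotropic Gaussian with mean `μ` and variance `v`. -/
noncomputable def isoGaussianPDF (v : ℝ≥0) (μ x : ι → ℝ) : ℝ := ∏ p, gaussianPDFReal (μ p) v (x p)

lemma isoGaussianPDF_nonneg (v : ℝ≥0) (μ x : ι → ℝ) : 0 ≤ isoGaussianPDF v μ x :=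
  Finset.prod_nonneg fun _ _ => gaussianPDFReal_nonneg _ _ _

lemma measurable_isoGaussianPDF (v : ℝ≥0) (μ : ι → ℝ) : Measurable (isoGaussianPDF v μ) :=
  Finset.measurable_prod _ fun p _ => (measurable_gaussianPDFReal _ _).comp (measurable_pi_apply p)

instance isProbabilityMeasure_isoGaussian (μ : ι → ℝ) (σ : ℝ) :
    IsProbabilityMeasure (isoGaussian μ σ) := by
  unfold isoGaussian
  infer_instance

lemma mk_sq_ne_zero {σ : ℝ} (hσ : 0 < σ) : NNReal.mk (σ ^ 2) (sq_nonneg σ) ≠ 0 := by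
  intro h
  have := congrArg NNReal.toReal h
  simp at this
  exact hσ.ne' this

lemma isoGaussian_eq_withDensity (μ : ι → ℝ) {σ : ℝ} (hσ : 0 < σ) :
    isoGaussian μ σ = volume.withDensity fun x =>
      ENNReal.ofReal (isoGaussianPDF (NNReal.mk (σ ^ 2) (sq_nonneg σ)) μ x) := by
  unfold isoGaussian isoGaussianPDF
  rw [volume_pi, ← pi_withDensity_ofReal (fun _ => volume)
    (fun p => gaussianPDFReal (μ p) _) (fun _ _ => gaussianPDFReal_nonneg _ _ _)
    fun _ => integrable_gaussianPDFReal _ _]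
  congr 1
  ext1 p
  rw [gaussianReal_of_var_ne_zero _ (mk_sq_ne_zero hσ)]
  rfl

lemma isoGaussianPDF_eq (v : ℝ≥0) (μ x : ι → ℝ) :
    isoGaussianPDF v μ x = (√(2 * Real.pi * v))⁻¹ ^ Fintype.card ι *
      Real.exp (-((x - μ) ⬝ᵥ (x - μ)) / (2 * v)) := by
  unfold isoGaussianPDF
  simp only [gaussianPDFReal_def]
  rw [Finset.prod_mul_distrib, Finset.prod_const, ← Real.exp_sum, Finset.card_univ]
  congr 2
  rw [← Finset.sum_div]
  congr 1
  simp [dotProduct, sq]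

variable [DecidableEq ι]

lemma mulVec_dotProduct_mulVec_of_mem_orthogonalGroup {U : Matrix ι ι ℝ}
    (hU : U ∈ Matrix.orthogonalGroup ι ℝ) (x y : ι → ℝ) : (U *ᵥ x) ⬝ᵥ (U *ᵥ y) = x ⬝ᵥ y := by
  rw [Matrix.dotProduct_mulVec, ← Matrix.mulVec_transpose, Matrix.mulVec_mulVec]
  have := (Matrix.mem_orthogonalGroup_iff' (n := ι) (R := ℝ)).1 hU
  rw [this, Matrix.one_mulVec]

/-- Multiplication by an orthogonal matrix. -/
noncomputable def orthogonalEquiv {U : Matrix ι ι ℝ} (hU : U ∈ Matrix.orthogonalGroup ι ℝ) :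
    (ι → ℝ) ≃ᵐ (ι → ℝ) where
  toFun x := U *ᵥ x
  invFun x := Uᵀ *ᵥ x
  left_inv x := by
    dsimp only
    rw [Matrix.mulVec_mulVec, (Matrix.mem_orthogonalGroup_iff' _ _).1 hU, Matrix.one_mulVec]
  right_inv x := by
    dsimp only
    rw [Matrix.mulVec_mulVec, (Matrix.mem_orthogonalGroup_iff _ _).1 hU, Matrix.one_mulVec]
  measurable_toFun := by
    exact (Continuous.matrix_mulVec continuous_const continuous_id).measurable
  measurable_invFun := by
    exact (Continuous.matrix_mulVec continuous_const continuous_id).measurable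

lemma map_volume_orthogonal {U : Matrix ι ι ℝ} (hU : U ∈ Matrix.orthogonalGroup ι ℝ) :
    (volume : Measure (ι → ℝ)).map (fun x => U *ᵥ x) = volume := by
  have hd : |U.det| = 1 := by
    have h := congrArg Matrix.det ((Matrix.mem_orthogonalGroup_iff (n := ι) (R := ℝ)).1 hU)
    rw [Matrix.det_mul, Matrix.det_transpose, Matrix.det_one] at h
    rcases mul_self_eq_one_iff.1 h with h | h <;> simp [h]
  have h0 : U.det ≠ 0 := by
    intro h
    simp [h] at hd
  have := Real.map_matrix_volume_pi_eq_smul_volume_pi h0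
  rw [abs_inv, hd, inv_one, ENNReal.ofReal_one, one_smul] at this
  exact this

/-- The density depends on `x` only through the Euclidean distance to the mean, which `U` preserves,
as it preserves Lebesgue measure. -/
lemma map_isoGaussian_orthogonal {U : Matrix ι ι ℝ} (hU : U ∈ Matrix.orthogonalGroup ι ℝ)
    (μ : ι → ℝ) {σ : ℝ} (hσ : 0 < σ) :
    (isoGaussian μ σ).map (fun x => U *ᵥ x) = isoGaussian (U *ᵥ μ) σ := by
  have hm : Measurable fun x : ι → ℝ => U *ᵥ x := (orthogonalEquiv hU).measurable
  rw [isoGaussian_eq_withDensity μ hσ, isoGaussian_eq_withDensity _ hσ]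
  ext s hs
  rw [Measure.map_apply hm hs, withDensity_apply _ (hm hs), withDensity_apply _ hs]
  conv_rhs => rw [← map_volume_orthogonal hU]
  rw [setLIntegral_map hs (measurable_isoGaussianPDF _ _).ennreal_ofReal hm]
  refine lintegral_congr fun x => ?_
  rw [isoGaussianPDF_eq, isoGaussianPDF_eq, ← Matrix.mulVec_sub,
    mulVec_dotProduct_mulVec_of_mem_orthogonalGroup hU]

/-- Two densities whose means are opposite in one coordinate and agree in the others. -/
lemma isoGaussianPDF_mul_of_flip {v : ℝ≥0} (hv : v ≠ 0) (p₀ : ι) {u u' u₀ : ι → ℝ}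
    (h : ∀ p, p ≠ p₀ → u p = u₀ p) (h' : ∀ p, p ≠ p₀ → u' p = u₀ p) (h0 : u₀ p₀ = 0)
    (hn : u' p₀ = -u p₀) (x : ι → ℝ) :
    isoGaussianPDF v u x * isoGaussianPDF v u' x =
      (Real.exp (-(u p₀) ^ 2 / (2 * v)) * isoGaussianPDF v u₀ x) ^ 2 := by
  have hv' : (v : ℝ) ≠ 0 := by exact_mod_cast hv
  unfold isoGaussianPDF
  rw [← Finset.mul_prod_erase Finset.univ (fun p => gaussianPDFReal (u p) v (x p))
      (Finset.mem_univ p₀),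
    ← Finset.mul_prod_erase Finset.univ (fun p => gaussianPDFReal (u' p) v (x p))
      (Finset.mem_univ p₀),
    ← Finset.mul_prod_erase Finset.univ (fun p => gaussianPDFReal (u₀ p) v (x p))
      (Finset.mem_univ p₀)]
  rw [Finset.prod_congr rfl fun p hp => by rw [h p (Finset.ne_of_mem_erase hp)],
    Finset.prod_congr (s₁ := Finset.univ.erase p₀) (f := fun p => gaussianPDFReal (u' p) v (x p)) rfl
      fun p hp => by rw [h' p (Finset.ne_of_mem_erase hp)], h0, hn]
  have key : gaussianPDFReal (u p₀) v (x p₀) * gaussianPDFReal (-u p₀) v (x p₀) =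
      (Real.exp (-(u p₀) ^ 2 / (2 * v)) * gaussianPDFReal 0 v (x p₀)) ^ 2 := by
    simp only [gaussianPDFReal_def]
    rw [mul_mul_mul_comm, ← Real.exp_add, mul_left_comm (Real.exp _), mul_pow, ← Real.exp_add,
      ← Real.exp_nat_mul, pow_two (√_)⁻¹]
    congr 2
    field_simp
    push_cast
    ring
  calc _ = (gaussianPDFReal (u p₀) v (x p₀) * gaussianPDFReal (-u p₀) v (x p₀)) *
      (∏ p ∈ Finset.univ.erase p₀, gaussianPDFReal (u₀ p) v (x p)) ^ 2 := by ring
    _ = _ := by rw [key]; ring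

end Gaussian

/-! ### Mixtures with one mean vector per patch -/

section Mixture

variable {ι : Type} [Fintype ι]

/-- The law of `(x, y)` where `y` is uniform on `{1, -1}` and `x | y ∼ N(y m, σ² I)`. -/
noncomputable def signedGaussian (m : ι → ℝ) (σ : ℝ) : Measure ((ι → ℝ) × ℝ) :=
  (2 : ℝ≥0∞)⁻¹ • ((isoGaussian m σ).prod (Measure.dirac 1)
    + (isoGaussian (-m) σ).prod (Measure.dirac (-1)))

/-- The uniform mixture of signed Gaussians with mean vectors `m 0, …, m (k - 1)`. -/
noncomputable def signedMixture {k : ℕ} (m : Fin k → ι → ℝ) (σ : ℝ) : Measure ((ι → ℝ) × ℝ) :=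
  (k : ℝ≥0∞)⁻¹ • ∑ t : Fin k, signedGaussian (m t) σ

lemma DSD_eq_signedMixture (k d : ℕ) (ws : EuclideanSpace ℝ (Fin d)) (σ : ℝ) :
    DSD k d ws σ = signedMixture (fun t : Fin k => meanVec ws t) σ := rfl

instance isProbabilityMeasure_signedGaussian (m : ι → ℝ) (σ : ℝ) :
    IsProbabilityMeasure (signedGaussian m σ) := by
  constructor
  rw [signedGaussian, Measure.smul_apply, Measure.add_apply, measure_univ, measure_univ,
    smul_eq_mul, one_add_one_eq_two]
  exact ENNReal.inv_mul_cancel (by norm_num) (by norm_num)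

instance isProbabilityMeasure_signedMixture {k : ℕ} [NeZero k] (m : Fin k → ι → ℝ) (σ : ℝ) :
    IsProbabilityMeasure (signedMixture m σ) := by
  constructor
  rw [signedMixture, Measure.smul_apply, Measure.finsetSum_apply]
  simp only [measure_univ, Finset.sum_const, Finset.card_univ, Fintype.card_fin, smul_eq_mul,
    nsmul_eq_mul, mul_one]
  exact ENNReal.inv_mul_cancel (by simpa using NeZero.ne k) (by simp)

/-- The reference measure for the densities of signed Gaussians. -/
noncomputable def labelledVolume (ι : Type) [Fintype ι] : Measure ((ι → ℝ) × ℝ) :=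
  (volume : Measure (ι → ℝ)).prod (Measure.dirac 1 + Measure.dirac (-1))

instance : SigmaFinite (labelledVolume ι) := by
  unfold labelledVolume
  infer_instance

/-- The sign of a label. -/
noncomputable def labelSign (y : ℝ) : ℝ := if 0 < y then 1 else -1

/-- The density of a signed Gaussian. -/
noncomputable def signedGaussianPDF (v : ℝ≥0) (m : ι → ℝ) (z : (ι → ℝ) × ℝ) : ℝ :=
  2⁻¹ * isoGaussianPDF v (labelSign z.2 • m) z.1

lemma signedGaussianPDF_nonneg (v : ℝ≥0) (m : ι → ℝ) (z : (ι → ℝ) × ℝ) :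
    0 ≤ signedGaussianPDF v m z :=
  mul_nonneg (by norm_num) (isoGaussianPDF_nonneg _ _ _)

lemma measurable_signedGaussianPDF (v : ℝ≥0) (m : ι → ℝ) :
    Measurable (signedGaussianPDF v m) := by
  have h : signedGaussianPDF v m = fun z => if 0 < z.2 then 2⁻¹ * isoGaussianPDF v m z.1 else
      2⁻¹ * isoGaussianPDF v (-m) z.1 := by
    ext z
    by_cases hz : 0 < z.2 <;> simp [signedGaussianPDF, labelSign, hz]
  rw [h]
  exact Measurable.ite (measurableSet_lt measurable_const measurable_snd)
    (((measurable_isoGaussianPDF v m).comp measurable_fst).const_mul _)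
    (((measurable_isoGaussianPDF v (-m)).comp measurable_fst).const_mul _)

lemma signedGaussian_eq_withDensity (m : ι → ℝ) {σ : ℝ} (hσ : 0 < σ) :
    signedGaussian m σ = (labelledVolume ι).withDensity fun z =>
      ENNReal.ofReal (signedGaussianPDF (NNReal.mk (σ ^ 2) (sq_nonneg σ)) m z) := by
  have hm := measurable_signedGaussianPDF (NNReal.mk (σ ^ 2) (sq_nonneg σ)) m
  ext s hs
  rw [withDensity_apply _ hs, labelledVolume, Measure.prod_add, Measure.restrict_add,
    lintegral_add_measure, Measure.prod_dirac, Measure.prod_dirac,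
    setLIntegral_map hs hm.ennreal_ofReal (by fun_prop),
    setLIntegral_map hs hm.ennreal_ofReal (by fun_prop), signedGaussian, Measure.smul_apply,
    Measure.add_apply, Measure.prod_dirac, Measure.prod_dirac,
    Measure.map_apply (by fun_prop) hs, Measure.map_apply (by fun_prop) hs,
    isoGaussian_eq_withDensity _ hσ, isoGaussian_eq_withDensity _ hσ,
    withDensity_apply _ (by exact (measurable_prodMk_right hs)),
    withDensity_apply _ (by exact (measurable_prodMk_right hs)), smul_eq_mul, mul_add,
    ← lintegral_const_mul _ (measurable_isoGaussianPDF _ _).ennreal_ofReal,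
    ← lintegral_const_mul _ (measurable_isoGaussianPDF _ _).ennreal_ofReal]
  congr 1
  · refine lintegral_congr fun x => ?_
    simp only [signedGaussianPDF, labelSign]
    rw [ENNReal.ofReal_mul (by norm_num), ENNReal.ofReal_inv_of_pos (by norm_num)]
    simp
  · refine lintegral_congr fun x => ?_
    simp only [signedGaussianPDF, labelSign]
    rw [ENNReal.ofReal_mul (by norm_num), ENNReal.ofReal_inv_of_pos (by norm_num), if_neg (by norm_num)]
    simp

lemma lintegral_signedGaussianPDF {σ : ℝ} (hσ : 0 < σ) (m : ι → ℝ) :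
    ∫⁻ z, ENNReal.ofReal (signedGaussianPDF (NNReal.mk (σ ^ 2) (sq_nonneg σ)) m z)
      ∂(labelledVolume ι) = 1 := by
  rw [← setLIntegral_univ, ← withDensity_apply _ MeasurableSet.univ,
    ← signedGaussian_eq_withDensity m hσ, measure_univ]

lemma integrable_signedGaussianPDF {σ : ℝ} (hσ : 0 < σ) (m : ι → ℝ) :
    Integrable (signedGaussianPDF (NNReal.mk (σ ^ 2) (sq_nonneg σ)) m) (labelledVolume ι) := by
  refine ⟨(measurable_signedGaussianPDF _ _).aestronglyMeasurable, ?_⟩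
  rw [hasFiniteIntegral_iff_ofReal (Filter.Eventually.of_forall (signedGaussianPDF_nonneg _ _)),
    lintegral_signedGaussianPDF hσ]
  exact ENNReal.one_lt_top

lemma integral_signedGaussianPDF {σ : ℝ} (hσ : 0 < σ) (m : ι → ℝ) :
    ∫ z, signedGaussianPDF (NNReal.mk (σ ^ 2) (sq_nonneg σ)) m z ∂(labelledVolume ι) = 1 := by
  rw [integral_eq_lintegral_of_nonneg_ae
    (Filter.Eventually.of_forall (signedGaussianPDF_nonneg _ _))
    (measurable_signedGaussianPDF _ _).aestronglyMeasurable, lintegral_signedGaussianPDF hσ]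
  simp

lemma signedMixture_eq_withDensity {k : ℕ} [NeZero k] (m : Fin k → ι → ℝ) {σ : ℝ} (hσ : 0 < σ) :
    signedMixture m σ = (labelledVolume ι).withDensity fun z => ENNReal.ofReal
      ((k : ℝ)⁻¹ * ∑ t, signedGaussianPDF (NNReal.mk (σ ^ 2) (sq_nonneg σ)) (m t) z) := by
  have hk : (0 : ℝ) < k := by exact_mod_cast Nat.pos_of_ne_zero (NeZero.ne k)
  ext s hs
  rw [withDensity_apply _ hs, signedMixture, Measure.smul_apply, Measure.finsetSum_apply,
    smul_eq_mul]
  simp_rw [signedGaussian_eq_withDensity _ hσ, withDensity_apply _ hs]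
  rw [← lintegral_finsetSum _ fun t _ => (measurable_signedGaussianPDF _ _).ennreal_ofReal,
    ← lintegral_const_mul _ (Finset.measurable_sum _ fun t _ =>
      (measurable_signedGaussianPDF _ _).ennreal_ofReal)]
  refine lintegral_congr fun z => ?_
  rw [ENNReal.ofReal_mul (by positivity), ENNReal.ofReal_inv_of_pos hk, ENNReal.ofReal_natCast,
    ENNReal.ofReal_sum_of_nonneg fun t _ => signedGaussianPDF_nonneg _ _ _]

lemma map_signedMixture_orthogonal [DecidableEq ι] {k : ℕ} {U : Matrix ι ι ℝ}
    (hU : U ∈ Matrix.orthogonalGroup ι ℝ) (m : Fin k → ι → ℝ) {σ : ℝ} (hσ : 0 < σ) :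
    (signedMixture m σ).map (Prod.map (fun x => U *ᵥ x) id) =
      signedMixture (fun t => U *ᵥ m t) σ := by
  have hm : Measurable fun x : ι → ℝ => U *ᵥ x := (orthogonalEquiv hU).measurable
  have h : ∀ m : ι → ℝ, (signedGaussian m σ).map (Prod.map (fun x => U *ᵥ x) id) =
      signedGaussian (U *ᵥ m) σ := by
    intro m
    rw [signedGaussian, Measure.map_smul, Measure.map_add _ _ (hm.prodMap measurable_id),
      ← Measure.map_prod_map _ _ hm measurable_id, ← Measure.map_prod_map _ _ hm measurable_id,
      map_isoGaussian_orthogonal hU _ hσ, map_isoGaussian_orthogonal hU _ hσ, Measure.map_id,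
      Measure.map_id, Matrix.mulVec_neg]
    rfl
  rw [signedMixture, Measure.map_smul, ← Measure.mapₗ_apply_of_measurable
    (hm.prodMap measurable_id), map_sum]
  simp_rw [Measure.mapₗ_apply_of_measurable (hm.prodMap measurable_id), h]
  rfl

end Mixture

/-! ### Hellinger affinity of two mixtures that differ by one sign -/

section Flip

variable {ι : Type} [Fintype ι] [DecidableEq ι]

/-- The geometric mean of two Gaussian densities centred at `±a` is `exp(-a²/(2v))` times the
density centred at `0`. The label multiplies both means by the same sign, which disappears in `a²`.
-/
lemma signedGaussianPDF_mul_of_flip {v : ℝ≥0} (hv : v ≠ 0) (p₀ : ι) {u u' : ι → ℝ}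
    (h : ∀ p, p ≠ p₀ → u' p = u p) (hn : u' p₀ = -u p₀) (z : (ι → ℝ) × ℝ) :
    signedGaussianPDF v u z * signedGaussianPDF v u' z =
      (Real.exp (-(u p₀) ^ 2 / (2 * v)) * signedGaussianPDF v (Function.update u p₀ 0) z) ^ 2 := by
  have hs : labelSign z.2 ^ 2 = 1 := by
    unfold labelSign
    split_ifs <;> norm_num
  have := isoGaussianPDF_mul_of_flip hv p₀ (u := labelSign z.2 • u) (u' := labelSign z.2 • u')
    (u₀ := labelSign z.2 • Function.update u p₀ 0)
    (fun p hp => by simp [Function.update_of_ne hp])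
    (fun p hp => by simp [Function.update_of_ne hp, h p hp]) (by simp) (by simp [hn]) z.1
  simp only [Pi.smul_apply, smul_eq_mul, mul_pow, hs, one_mul] at this
  unfold signedGaussianPDF
  rw [mul_mul_mul_comm, this]
  ring

/-- Cauchy–Schwarz for `(√q, √a)` and `(√q, √b)`: the part `q` common to two mixtures enters their
affinity in full. -/
lemma sq_add_le_of_sq_eq {q a b c : ℝ} (hq : 0 ≤ q) (ha : 0 ≤ a) (hb : 0 ≤ b) (hc : a * b = c ^ 2) :
    (q + c) ^ 2 ≤ (q + a) * (q + b) := by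
  have h : 2 * c ≤ a + b := by
    refine le_of_sq_le_sq ?_ (add_nonneg ha hb)
    nlinarith [sq_nonneg (a - b)]
  nlinarith

/-- Changing the sign of one coordinate of one mean vector of a mixture. -/
lemma integral_sub_integral_flip_le {k : ℕ} [NeZero k] {σ : ℝ} (hσ : 0 < σ) (t₀ : Fin k) (p₀ : ι)
    {m m' : Fin k → ι → ℝ} (ht : ∀ t, t ≠ t₀ → m' t = m t)
    (h : ∀ p, p ≠ p₀ → m' t₀ p = m t₀ p) (hn : m' t₀ p₀ = -m t₀ p₀) (n : ℕ)
    {g : (Fin n → (ι → ℝ) × ℝ) → ℝ} (hg : Measurable g) (hb : ∀ x, |g x| ≤ 1) {l : ℝ}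
    (hl : 0 < l) :
    ∫ S, g S ∂(Measure.pi fun _ => signedMixture m σ) -
      ∫ S, g S ∂(Measure.pi fun _ => signedMixture m' σ) ≤
    l * (n * ((k : ℝ)⁻¹ * (1 - Real.exp (-(m t₀ p₀) ^ 2 / (2 * σ ^ 2))))) +
      (∫ S, g S ^ 2 ∂(Measure.pi fun _ => signedMixture m σ) +
        ∫ S, g S ^ 2 ∂(Measure.pi fun _ => signedMixture m' σ)) / l := by
  have hk : (1 : ℝ) ≤ k := by exact_mod_cast Nat.one_le_iff_ne_zero.2 (NeZero.ne k)
  have hk0 : (0 : ℝ) < k := by linarith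
  set v := NNReal.mk (σ ^ 2) (sq_nonneg σ) with hv
  set E := Real.exp (-(m t₀ p₀) ^ 2 / (2 * σ ^ 2)) with hE
  have hE0 : 0 ≤ E := (Real.exp_pos _).le
  have hE1 : E ≤ 1 := by
    rw [hE, Real.exp_le_one_iff]
    exact div_nonpos_of_nonpos_of_nonneg (by nlinarith [sq_nonneg (m t₀ p₀)]) (by positivity)
  set Q : (ι → ℝ) × ℝ → ℝ := fun z => ∑ t ∈ Finset.univ.erase t₀, signedGaussianPDF v (m t) z
  have hQ : ∀ z, 0 ≤ Q z := fun z => Finset.sum_nonneg fun t _ => signedGaussianPDF_nonneg _ _ _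
  have hQi : Integrable Q (labelledVolume ι) :=
    integrable_finsetSum _ fun t _ => integrable_signedGaussianPDF hσ _
  have hQ1 : ∫ z, Q z ∂(labelledVolume ι) = k - 1 := by
    rw [integral_finsetSum _ fun t _ => integrable_signedGaussianPDF hσ _]
    rw [Finset.sum_congr rfl fun t _ => integral_signedGaussianPDF hσ (m t)]
    rw [Finset.sum_const, Finset.card_erase_of_mem (Finset.mem_univ _), Finset.card_univ,
      Fintype.card_fin, nsmul_eq_mul, mul_one, Nat.cast_sub (Nat.one_le_iff_ne_zero.2 (NeZero.ne k))]
    simp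
  have hp : ∀ z, (k : ℝ)⁻¹ * ∑ t, signedGaussianPDF v (m t) z =
      (k : ℝ)⁻¹ * (Q z + signedGaussianPDF v (m t₀) z) := fun z => by
    rw [Finset.sum_erase_add _ _ (Finset.mem_univ t₀)]
  have hq : ∀ z, (k : ℝ)⁻¹ * ∑ t, signedGaussianPDF v (m' t) z =
      (k : ℝ)⁻¹ * (Q z + signedGaussianPDF v (m' t₀) z) := fun z => by
    rw [← Finset.sum_erase_add _ _ (Finset.mem_univ t₀)]
    congr 2
    exact Finset.sum_congr rfl fun t h => by rw [ht t (Finset.ne_of_mem_erase h)]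
  have hi := fun u : ι → ℝ => integrable_signedGaussianPDF hσ u
  have h1 := fun u : ι → ℝ => integral_signedGaussianPDF hσ u
  have hsum : ∀ c : ℝ, ∀ u : ι → ℝ,
      ∫ z, (k : ℝ)⁻¹ * (Q z + c * signedGaussianPDF v u z) ∂(labelledVolume ι) =
        (k : ℝ)⁻¹ * (k - 1 + c) := fun c u => by
    rw [integral_const_mul, integral_add hQi ((hi u).const_mul c), hQ1, integral_const_mul, h1,
      mul_one]
  have hsum1 : ∀ u : ι → ℝ,
      ∫ z, (k : ℝ)⁻¹ * (Q z + signedGaussianPDF v u z) ∂(labelledVolume ι) = 1 := fun u => by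
    have := hsum 1 u
    simp only [one_mul, sub_add_cancel] at this
    rw [this]
    exact inv_mul_cancel₀ hk0.ne'
  rw [signedMixture_eq_withDensity m hσ, signedMixture_eq_withDensity m' hσ]
  simp_rw [← hv, hp, hq]
  -- The function `s` is a lower bound for the geometric mean of the two mixture densities: the
  -- unchanged components, plus `E` times the changed one with the coordinate `p₀` of its mean set
  -- to zero.
  have main := integral_pi_sub_integral_pi_le (ν := labelledVolume ι)
    (p := fun z => (k : ℝ)⁻¹ * (Q z + signedGaussianPDF v (m t₀) z))
    (q := fun z => (k : ℝ)⁻¹ * (Q z + signedGaussianPDF v (m' t₀) z))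
    (s := fun z => (k : ℝ)⁻¹ * (Q z + E * signedGaussianPDF v (Function.update (m t₀) p₀ 0) z))
    (fun z => mul_nonneg (by positivity) (add_nonneg (hQ z) (signedGaussianPDF_nonneg _ _ _)))
    (fun z => mul_nonneg (by positivity) (add_nonneg (hQ z) (signedGaussianPDF_nonneg _ _ _)))
    (fun z => by
      have := sq_add_le_of_sq_eq (hQ z) (signedGaussianPDF_nonneg v (m t₀) z)
        (signedGaussianPDF_nonneg v (m' t₀) z)
        (signedGaussianPDF_mul_of_flip (mk_sq_ne_zero hσ) p₀ h hn z)
      rw [mul_pow, mul_mul_mul_comm, ← sq (k : ℝ)⁻¹]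
      exact mul_le_mul_of_nonneg_left this (by positivity))
    ((hQi.add (hi _)).const_mul _) ((hQi.add (hi _)).const_mul _)
    ((hQi.add ((hi _).const_mul _)).const_mul _) (hsum1 _) (hsum1 _) n hg hb hl
  refine main.trans (add_le_add_left (mul_le_mul_of_nonneg_left ?_ hl.le) _)
  rw [hsum]
  have hβ : (k : ℝ)⁻¹ * (k - 1 + E) = 1 + -((k : ℝ)⁻¹ * (1 - E)) := by
    field_simp
    ring
  rw [hβ]
  have hle : (k : ℝ)⁻¹ * (1 - E) ≤ 1 := by
    rw [inv_mul_le_iff₀ hk0]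
    linarith
  -- Bernoulli's inequality: the affinity defect grows at most linearly in `n`.
  have := one_add_mul_le_pow (a := -((k : ℝ)⁻¹ * (1 - E))) (by linarith) n
  linarith

end Flip

/-! ### Hypercube of signal directions -/

/-- The sign `±1` of a Boolean. -/
def boolSign (b : Bool) : ℝ := if b then 1 else -1

lemma boolSign_sq (b : Bool) : boolSign b ^ 2 = 1 := by cases b <;> simp [boolSign]

lemma boolSign_not (b : Bool) : boolSign (!b) = -boolSign b := by cases b <;> simp [boolSign]

/-- The unit vector in direction of the signs of patch `t`. -/
noncomputable def signVec {k d : ℕ} (ε : Fin k × Fin d → Bool) (t : Fin k) :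
    EuclideanSpace ℝ (Fin d) :=
  WithLp.toLp 2 fun j => boolSign (ε (t, j)) / √d

lemma norm_signVec {k d : ℕ} [NeZero d] (ε : Fin k × Fin d → Bool) (t : Fin k) :
    ‖signVec ε t‖ = 1 := by
  have hd : (d : ℝ) ≠ 0 := by exact_mod_cast NeZero.ne d
  rw [EuclideanSpace.norm_eq, Real.sqrt_eq_one]
  simp only [signVec, Real.norm_eq_abs, sq_abs, div_pow, boolSign_sq, Real.sq_sqrt (Nat.cast_nonneg d)]
  simp [hd]

/-- The mean vectors that belong to an assignment of signs. -/
noncomputable def signMean {k d : ℕ} (ε : Fin k × Fin d → Bool) (t : Fin k) : Fin k × Fin d → ℝ :=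
  meanVec (signVec ε t) t

/-- Negation of one entry of an assignment of signs. -/
def flipSign {ι : Type} [DecidableEq ι] (p : ι) : Equiv.Perm (ι → Bool) where
  toFun ε := Function.update ε p (!ε p)
  invFun ε := Function.update ε p (!ε p)
  left_inv ε := by simp
  right_inv ε := by simp

lemma flipSign_apply {ι : Type} [DecidableEq ι] (p : ι) (ε : ι → Bool) :
    flipSign p ε = Function.update ε p (!ε p) := rfl

/-- Pair each `ε` with its flip. The flip reverses `boolSign (ε p)`, so the left side of `h` sums to
twice the wanted quantity; this is the source of the factor `1/2`. -/
lemma sum_boolSign_mul_le {ι : Type} [Fintype ι] [DecidableEq ι] (p : ι) {a b : (ι → Bool) → ℝ}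
    {r l : ℝ} (h : ∀ ε, boolSign (ε p) * (a ε - a (flipSign p ε)) ≤
      l * r + (b ε + b (flipSign p ε)) / l) :
    ∑ ε, boolSign (ε p) * a ε ≤ Fintype.card (ι → Bool) * (l * r / 2) + (∑ ε, b ε) / l := by
  have h1 : ∑ ε, boolSign (ε p) * a (flipSign p ε) = -∑ ε, boolSign (ε p) * a ε := by
    rw [← Equiv.sum_comp (flipSign p) fun ε => boolSign (ε p) * a ε, ← Finset.sum_neg_distrib]
    refine Finset.sum_congr rfl fun ε _ => ?_
    rw [flipSign_apply p ε, Function.update_self, boolSign_not]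
    ring
  have h2 := Finset.sum_le_sum fun ε (_ : ε ∈ Finset.univ) => h ε
  simp_rw [mul_sub] at h2
  rw [Finset.sum_sub_distrib, h1, Finset.sum_add_distrib, ← Finset.sum_div,
    Finset.sum_add_distrib, Equiv.sum_comp (flipSign p) b, Finset.sum_const, Finset.card_univ,
    nsmul_eq_mul] at h2
  have : (∑ ε, b ε + ∑ ε, b ε) / l = 2 * ((∑ ε, b ε) / l) := by ring
  rw [this] at h2
  linarith

/-- From `n` samples, few of the signs can be recovered. -/
lemma sum_integral_sign_le {k d : ℕ} [NeZero k] [NeZero d] {σ : ℝ} (hσ : 0 < σ) (n : ℕ)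
    {g : (Fin n → (Fin k × Fin d → ℝ) × ℝ) → Fin k × Fin d → ℝ}
    (hg : ∀ p, Measurable fun S => g S p) (hb : ∀ S t, ∑ j, g S (t, j) ^ 2 ≤ 1)
    {l : ℝ} (hl : 0 < l) :
    ∑ ε, ∑ p, boolSign (ε p) * ∫ S, g S p ∂(Measure.pi fun _ => signedMixture (signMean ε) σ) ≤
      Fintype.card (Fin k × Fin d → Bool) *
        (d * l * (n * (1 - Real.exp (-1 / (2 * (σ ^ 2 * d))))) / 2 + k / l) := by
  have hk : (0 : ℝ) < k := by exact_mod_cast Nat.pos_of_ne_zero (NeZero.ne k)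
  have hd : (0 : ℝ) < d := by exact_mod_cast Nat.pos_of_ne_zero (NeZero.ne d)
  have hb1 : ∀ S p, |g S p| ≤ 1 := by
    rintro S ⟨t, j⟩
    rw [← sq_le_one_iff_abs_le_one]
    exact (Finset.single_le_sum (f := fun j => g S (t, j) ^ 2) (fun _ _ => sq_nonneg _)
      (Finset.mem_univ j)).trans (hb S t)
  have hi : ∀ (ε : Fin k × Fin d → Bool) p, Integrable (fun S => g S p ^ 2)
      (Measure.pi fun _ => signedMixture (signMean ε) σ) := fun ε p =>
    Integrable.of_bound ((hg p).pow_const 2).aestronglyMeasurable 1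
      (Filter.Eventually.of_forall fun S => by
        rw [Real.norm_eq_abs, abs_pow]
        exact pow_le_one₀ (abs_nonneg _) (hb1 S p))
  rw [Finset.sum_comm]
  have h1 : ∀ p : Fin k × Fin d, ∑ ε, boolSign (ε p) *
      ∫ S, g S p ∂(Measure.pi fun _ => signedMixture (signMean ε) σ) ≤
      Fintype.card (Fin k × Fin d → Bool) *
        (l * (n * ((k : ℝ)⁻¹ * (1 - Real.exp (-1 / (2 * (σ ^ 2 * d)))))) / 2) +
      (∑ ε, ∫ S, g S p ^ 2 ∂(Measure.pi fun _ => signedMixture (signMean ε) σ)) / l := by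
    rintro ⟨t₀, j₀⟩
    refine sum_boolSign_mul_le (t₀, j₀) fun ε => ?_
    have hsm : ∀ t p, signMean (flipSign (t₀, j₀) ε) t p =
        if p = (t₀, j₀) ∧ t = t₀ then - signMean ε t p else signMean ε t p := by
      rintro t ⟨i, j⟩
      simp only [signMean, meanVec, signVec, flipSign_apply]
      by_cases hit : i = t
      · subst hit
        by_cases hp : (i, j) = (t₀, j₀)
        · obtain ⟨rfl, rfl⟩ := Prod.mk.inj hp
          simp [boolSign_not, neg_div]
        · simp [hp]
      · simp [hit]
    have hval : ∀ ε : Fin k × Fin d → Bool,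
        -(signMean ε t₀ (t₀, j₀)) ^ 2 / (2 * σ ^ 2) = -1 / (2 * (σ ^ 2 * d)) := fun ε => by
      simp only [signMean, meanVec, signVec, if_true, div_pow, boolSign_sq,
        Real.sq_sqrt (Nat.cast_nonneg d)]
      field_simp
    have hflip := fun {f : (Fin n → (Fin k × Fin d → ℝ) × ℝ) → ℝ} (hf : Measurable f)
        (hfb : ∀ S, |f S| ≤ 1) => integral_sub_integral_flip_le hσ t₀ (t₀, j₀) (m := signMean ε)
      (m' := signMean (flipSign (t₀, j₀) ε)) (fun t ht => by ext p; simp [hsm, ht])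
      (fun p hp => by simp [hsm, hp]) (by simp [hsm]) n hf hfb hl
    have hs : boolSign (ε (t₀, j₀)) = 1 ∨ boolSign (ε (t₀, j₀)) = -1 := by
      cases ε (t₀, j₀) <;> simp [boolSign]
    rcases hs with hs | hs
    · have := hflip (hg (t₀, j₀)) fun S => hb1 S _
      rw [hval] at this
      rw [hs, one_mul]
      exact this
    -- For a negative sign the bound is applied to `-g`, whose square is the same.
    · have := hflip (hg (t₀, j₀)).neg fun S => by simpa using hb1 S (t₀, j₀)
      rw [hval] at this
      simp only [Pi.neg_apply, integral_neg, neg_sq] at this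
      rw [hs]
      linarith
  refine (Finset.sum_le_sum fun p _ => h1 p).trans ?_
  rw [Finset.sum_add_distrib, Finset.sum_const, Finset.card_univ, ← Finset.sum_div,
    Finset.sum_comm, Fintype.card_prod, Fintype.card_fin, Fintype.card_fin, nsmul_eq_mul, mul_add]
  -- The `kd` coordinates cancel the factor `1/k` and leave `d`. The second moments add up to at
  -- most `k` rather than `kd`, because they sum to at most `1` in each patch.
  refine add_le_add (le_of_eq ?_) ?_
  · push_cast
    field_simp
  · rw [mul_div_assoc']
    refine div_le_div_of_nonneg_right ?_ hl.le
    rw [← nsmul_eq_mul, ← Finset.card_univ]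
    refine Finset.sum_le_card_nsmul _ _ _ fun ε _ => ?_
    rw [← integral_finsetSum _ fun p _ => hi ε p]
    refine (integral_mono (integrable_finsetSum _ fun p _ => hi ε p) (integrable_const (k : ℝ))
      fun S => ?_).trans (by simp)
    rw [Fintype.sum_prod_type]
    refine (Finset.sum_le_sum fun t _ => hb S t).trans (by simp)

/-! ### From real integrals to extended nonnegative ones -/

lemma ofReal_sum_le {α : Type*} (s : Finset α) (f : α → ℝ) :
    ENNReal.ofReal (∑ i ∈ s, f i) ≤ ∑ i ∈ s, ENNReal.ofReal (f i) := by
  classical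
  induction s using Finset.induction_on with
  | empty => simp
  | insert a s ha ih =>
    rw [Finset.sum_insert ha, Finset.sum_insert ha]
    exact ENNReal.ofReal_add_le.trans (add_le_add_right ih _)

/-- Needed because the affine lower bound for the risk can be negative; truncating it at zero only
increases the integral. -/
lemma ofReal_integral_le_lintegral {α : Type*} [MeasurableSpace α] {μ : Measure α} {f : α → ℝ}
    (hf : Integrable f μ) : ENNReal.ofReal (∫ x, f x ∂μ) ≤ ∫⁻ x, ENNReal.ofReal (f x) ∂μ := by
  refine (ENNReal.ofReal_le_ofReal (integral_mono hf hf.pos_part fun x => le_max_left _ 0)).trans ?_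
  rw [ofReal_integral_eq_lintegral_ofReal hf.pos_part
    (Filter.Eventually.of_forall fun x => le_max_right _ _)]
  simp

/-! ### The risk of a locally connected network -/

/-- For `b ≥ 0` the activation is nondecreasing and 1-Lipschitz. -/
lemma lsa_add_le {b : ℝ} (hb : 0 ≤ b) (x a : ℝ) : lsa b (x + a) ≤ lsa b x + max a 0 := by
  unfold lsa
  rcases le_total (x + a - b) 0 with h1 | h1 <;> rcases le_total (-(x + a) - b) 0 with h2 | h2 <;>
  rcases le_total (x - b) 0 with h3 | h3 <;> rcases le_total (-x - b) 0 with h4 | h4 <;>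
  rcases le_total a 0 with h5 | h5 <;> simp only [max_eq_left, max_eq_right, h1, h2, h3, h4, h5] <;>
  linarith

lemma continuous_lsa (b : ℝ) : Continuous (lsa b) := by
  unfold lsa
  fun_prop

lemma continuous_lcn {k d : ℕ} (v : ParamIdx k d → ℝ) : Continuous (lcn v) :=
  continuous_finsetSum _ fun i _ => (continuous_lsa _).comp (by fun_prop)

/-- The correlation of the weights in patch `t` with a direction. -/
noncomputable def patchCorr {k d : ℕ} (v : ParamIdx k d → ℝ) (t : Fin k)
    (u : EuclideanSpace ℝ (Fin d)) : ℝ :=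
  ∑ j, weight v t j * u j

lemma abs_patchCorr_le {k d : ℕ} (v : ParamIdx k d → ℝ) (t : Fin k)
    {u : EuclideanSpace ℝ (Fin d)} (hu : ‖u‖ = 1) (hv : ‖weight v t‖ ≤ 1) :
    |patchCorr v t u| ≤ 1 := by
  have h : patchCorr v t u = inner ℝ u (weight v t) := by
    simp [patchCorr, PiLp.inner_apply]
  rw [h]
  refine (abs_real_inner_le_norm _ _).trans ?_
  rwa [hu, one_mul]

lemma lcn_add_meanVec_le {k d : ℕ} {v : ParamIdx k d → ℝ} (hb : 0 ≤ bias v) (t : Fin k)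
    (u : EuclideanSpace ℝ (Fin d)) (x : Fin k × Fin d → ℝ) :
    lcn v (x + meanVec u t) ≤ lcn v x + max (patchCorr v t u) 0 := by
  unfold lcn
  rw [← Finset.add_sum_erase _ _ (Finset.mem_univ t),
    ← Finset.add_sum_erase Finset.univ
      (fun i => lsa (bias v) (∑ j, weight v i j * x (i, j))) (Finset.mem_univ t)]
  have h1 : ∑ j, weight v t j * (x + meanVec u t) (t, j) =
      ∑ j, weight v t j * x (t, j) + patchCorr v t u := by
    simp [patchCorr, meanVec, mul_add, Finset.sum_add_distrib]
  have h2 : ∑ i ∈ Finset.univ.erase t,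
      lsa (bias v) (∑ j, weight v i j * (x + meanVec u t) (i, j)) =
      ∑ i ∈ Finset.univ.erase t, lsa (bias v) (∑ j, weight v i j * x (i, j)) := by
    refine Finset.sum_congr rfl fun i hi => ?_
    simp [meanVec, Finset.ne_of_mem_erase hi]
  rw [h1, h2]
  linarith [lsa_add_le hb (∑ j, weight v t j * x (t, j)) (patchCorr v t u)]

lemma map_add_isoGaussian {ι : Type} [Fintype ι] (μ : ι → ℝ) (σ : ℝ) :
    (isoGaussian 0 σ).map (fun x => x + μ) = isoGaussian μ σ := by
  unfold isoGaussian
  have := Measure.pi_map_pi (μ := fun p : ι => gaussianReal 0 (NNReal.mk (σ ^ 2) (sq_nonneg σ)))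
    (f := fun p x => x + μ p) fun p => (measurable_id.add_const _).aemeasurable
  simp_rw [gaussianReal_map_add_const, zero_add] at this
  exact this

/-- Couple the two labels through the same noise `x`. The outputs `p` at `x + μ` and `q` at `x - μ`
satisfy `p - q ≤ 2 max(ρ, 0) ≤ 1 + ρ` with `ρ = patchCorr v t u`, while `(p - 1)² + (q + 1)² ≥ 3/2 -
(p - q)`. The contribution of the other patches cancels in `p - q`. -/
lemma le_lintegral_signedGaussian {k d : ℕ} {v : ParamIdx k d → ℝ} (hb : 0 ≤ bias v) (t : Fin k)
    {u : EuclideanSpace ℝ (Fin d)} (hu : ‖u‖ = 1) (hv : ‖weight v t‖ ≤ 1) (σ : ℝ) :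
    ENNReal.ofReal (1 / 4 - patchCorr v t u / 2) ≤
      risk (lcn v) (signedGaussian (meanVec u t) σ) := by
  have hf : Measurable (lcn v) := (continuous_lcn v).measurable
  have hF : Measurable fun z : (Fin k × Fin d → ℝ) × ℝ =>
      ENNReal.ofReal ((lcn v z.1 - z.2) ^ 2) := by fun_prop
  rw [risk, signedGaussian, lintegral_smul_measure, lintegral_add_measure, Measure.prod_dirac,
    Measure.prod_dirac, lintegral_map hF (by fun_prop), lintegral_map hF (by fun_prop),
    ← map_add_isoGaussian, ← map_add_isoGaussian (-meanVec u t),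
    lintegral_map (by fun_prop) (by fun_prop), lintegral_map (by fun_prop) (by fun_prop),
    ← lintegral_add_left (by fun_prop)]
  have key : ∀ x, ENNReal.ofReal (2 * (1 / 4 - patchCorr v t u / 2)) ≤
      ENNReal.ofReal ((lcn v (x + meanVec u t) - 1) ^ 2) +
        ENNReal.ofReal ((lcn v (x + -meanVec u t) - -1) ^ 2) := by
    intro x
    rw [← ENNReal.ofReal_add (sq_nonneg _) (sq_nonneg _)]
    refine ENNReal.ofReal_le_ofReal ?_
    have h1 := lcn_add_meanVec_le hb t u x
    have h2 := lcn_add_meanVec_le hb t u (x + -meanVec u t)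
    rw [neg_add_cancel_right] at h2
    have h3 := abs_le.1 (abs_patchCorr_le v t hu hv)
    -- On `[-1, 1]` the positive part lies below its chord. This is where unit weights enter, and it
    -- makes the bound affine in the signal.
    have h4 : max (patchCorr v t u) 0 ≤ 1 / 2 + patchCorr v t u / 2 :=
      max_le (by linarith) (by linarith)
    nlinarith [sq_nonneg (lcn v (x + meanVec u t) - 1 / 2),
      sq_nonneg (lcn v (x + -meanVec u t) + 1 / 2)]
  have h2 : ENNReal.ofReal (1 / 4 - patchCorr v t u / 2) =
      2⁻¹ * ENNReal.ofReal (2 * (1 / 4 - patchCorr v t u / 2)) := by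
    rw [ENNReal.ofReal_mul (by norm_num), ← mul_assoc, ENNReal.ofReal_ofNat,
      ENNReal.inv_mul_cancel (by norm_num) (by norm_num), one_mul]
  rw [h2, smul_eq_mul]
  gcongr
  refine le_trans ?_ (lintegral_mono key)
  simp

/-- An affine lower bound for the risk of a network with unit weights. -/
lemma le_risk_signedMixture {k d : ℕ} [NeZero k] {v : ParamIdx k d → ℝ} (hb : 0 ≤ bias v)
    {u : Fin k → EuclideanSpace ℝ (Fin d)} (hu : ∀ t, ‖u t‖ = 1) (hv : ∀ t, ‖weight v t‖ ≤ 1)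
    (σ : ℝ) :
    ENNReal.ofReal (1 / 4 - (∑ t, patchCorr v t (u t)) / (2 * k)) ≤
      risk (lcn v) (signedMixture (fun t => meanVec (u t) t) σ) := by
  have hk : (0 : ℝ) < k := by exact_mod_cast Nat.pos_of_ne_zero (NeZero.ne k)
  have h : 1 / 4 - (∑ t, patchCorr v t (u t)) / (2 * k) =
      (k : ℝ)⁻¹ * ∑ t, (1 / 4 - patchCorr v t (u t) / 2) := by
    rw [Finset.sum_sub_distrib, ← Finset.sum_div _ fun t => patchCorr v t (u t), Finset.sum_const, Finset.card_univ,
      Fintype.card_fin, nsmul_eq_mul]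
    field_simp
  rw [h, ENNReal.ofReal_mul (by positivity), ENNReal.ofReal_inv_of_pos hk, ENNReal.ofReal_natCast,
    risk, signedMixture, lintegral_smul_measure, smul_eq_mul, lintegral_finsetSum_measure]
  gcongr
  refine (ofReal_sum_le _ _).trans ?_
  exact Finset.sum_le_sum fun t _ => le_lintegral_signedGaussian hb t (hu t) (hv t) σ

/-! ### Invariance of the expected risk -/

namespace IterAlgorithm

variable {ι κ : Type} [Fintype ι] [Fintype κ] {W : Set (κ → ℝ)} {n : ℕ}

lemma iterate_mem (A : IterAlgorithm ι κ W n) {v : κ → ℝ} (hv : v ∈ W)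
    (S : Fin n → (ι → ℝ) × ℝ) : ∀ t ≤ A.T, A.iterate v S t ∈ W
  | 0, _ => hv
  | t + 1, h => A.update_mem t h _ (A.iterate_mem hv S t (by omega)) S

lemma measurable_iterate (A : IterAlgorithm ι κ W n) : ∀ t ≤ A.T,
    Measurable fun q : (κ → ℝ) × (Fin n → (ι → ℝ) × ℝ) => A.iterate q.1 q.2 t
  | 0, _ => measurable_fst
  | t + 1, h => (A.measurable_update t h).comp
      ((A.measurable_iterate t (by omega)).prodMk measurable_snd)

lemma iterate_mulVec (A : IterAlgorithm ι κ W n) {U : Matrix ι ι ℝ} {V : Matrix κ κ ℝ}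
    (h : ∀ S : Fin n → (ι → ℝ) × ℝ, ∀ t < A.T, ∀ w ∈ W,
        V *ᵥ A.update t w S = A.update t (V *ᵥ w) (transform U S))
    {v : κ → ℝ} (hv : v ∈ W) (S : Fin n → (ι → ℝ) × ℝ) : ∀ t ≤ A.T,
    A.iterate (V *ᵥ v) (transform U S) t = V *ᵥ A.iterate v S t
  | 0, _ => rfl
  | t + 1, ht => by
    rw [iterate, iterate, A.iterate_mulVec h hv S t (by omega),
      h S t ht _ (A.iterate_mem hv S t (by omega))]

end IterAlgorithm

/-- Moving the data by `U` and the initial point by `V` moves the output by `V`, and then the loss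
at `U x` equals the old loss at `x`. The law of the initial point absorbs `V`. -/
lemma expectedRisk_map_eq {ι κ : Type} [Fintype ι] [Fintype κ] [DecidableEq ι] [DecidableEq κ]
    {W : Set (κ → ℝ)} {n : ℕ} (A : IterAlgorithm ι κ W n) {M : (κ → ℝ) → (ι → ℝ) → ℝ}
    {𝒰 : Set (Matrix ι ι ℝ)} (hA : A.IsEquivariant M 𝒰) {U : Matrix ι ι ℝ} (hU : U ∈ 𝒰)
    (hUo : U ∈ Matrix.orthogonalGroup ι ℝ) (P : Measure ((ι → ℝ) × ℝ)) [IsProbabilityMeasure P] :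
    expectedRisk A M (P.map (Prod.map (fun x => U *ᵥ x) id)) = expectedRisk A M P := by
  obtain ⟨𝒱, h𝒱, hex, hinit⟩ := hA
  obtain ⟨V, hV, hM, hup⟩ := hex U hU
  set e : ((ι → ℝ) × ℝ) ≃ᵐ ((ι → ℝ) × ℝ) :=
    (orthogonalEquiv hUo).prodCongr (MeasurableEquiv.refl ℝ) with he
  have hmap : P.map (Prod.map (fun x => U *ᵥ x) id) = P.map e := rfl
  have hpi : Measure.pi (fun _ : Fin n => P.map e) =
      (Measure.pi fun _ : Fin n => P).map (MeasurableEquiv.piCongrRight fun _ => e) :=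
    (Measure.pi_map_pi (μ := fun _ : Fin n => P) (f := fun _ => e)
      fun _ => e.measurable.aemeasurable).symm
  have hrisk : ∀ w ∈ W, risk (M (V *ᵥ w)) (P.map e) = risk (M w) P := by
    intro w hw
    rw [risk, lintegral_map_equiv]
    refine lintegral_congr fun z => ?_
    rw [hM z.1 w hw]
    rfl
  unfold expectedRisk
  rw [hmap, hpi]
  have hi : A.init.map (orthogonalEquiv (h𝒱 V hV).1) = A.init := hinit V hV
  -- Only the left side gets its initial law replaced by the image under `V`, so that initial point
  -- and data are transformed together.
  conv_lhs => rw [← hi]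
  rw [lintegral_map_equiv]
  refine lintegral_congr_ae ?_
  filter_upwards [A.init_mem] with v hv
  rw [lintegral_map_equiv]
  refine lintegral_congr fun S => ?_
  have ho : A.output (V *ᵥ v) (IterAlgorithm.transform U S) = V *ᵥ A.output v S :=
    A.iterate_mulVec hup hv S A.T le_rfl
  have : A.output (orthogonalEquiv (h𝒱 V hV).1 v)
      ((MeasurableEquiv.piCongrRight fun _ => e) S) = V *ᵥ A.output v S := ho
  rw [this]
  exact hrisk _ (A.iterate_mem hv S A.T le_rfl)

/-! ### Rotations of the patches -/

/-- The reflection in the hyperplane orthogonal to `a - b` exchanges two vectors of equal norm. -/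
lemma exists_orthogonal_mulVec_eq {d : ℕ} {a b : EuclideanSpace ℝ (Fin d)} (h : ‖a‖ = ‖b‖) :
    ∃ B ∈ Matrix.orthogonalGroup (Fin d) ℝ, B *ᵥ (fun j => a j) = fun j => b j := by
  set e := Submodule.reflection (Submodule.span ℝ {a - b})ᗮ
  set β := EuclideanSpace.basisFun (Fin d) ℝ
  refine ⟨LinearMap.toMatrix β.toBasis β.toBasis e.toLinearEquiv.toLinearMap,
    e.toMatrix_mem_unitaryGroup β β, ?_⟩
  have h1 := LinearMap.toMatrix_mulVec_repr β.toBasis β.toBasis e.toLinearEquiv.toLinearMap a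
  have h2 : e a = b := Submodule.reflection_sub h
  ext j
  have h3 : ⇑(β.toBasis.repr a) = fun j => a j := by
    ext i
    simp [β]
  rw [← h3, h1]
  simp [β, h2]

lemma blockDiagonal_mem_orthogonalGroup {k d : ℕ} {B : Fin k → Matrix (Fin d) (Fin d) ℝ}
    (hB : ∀ i, B i ∈ Matrix.orthogonalGroup (Fin d) ℝ) :
    (Matrix.of fun p q : Fin k × Fin d => if p.1 = q.1 then B p.1 p.2 q.2 else 0) ∈
      Matrix.orthogonalGroup (Fin k × Fin d) ℝ := by
  rw [Matrix.mem_orthogonalGroup_iff]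
  ext ⟨i, j⟩ ⟨i', j'⟩
  have h := congrFun (congrFun ((Matrix.mem_orthogonalGroup_iff _ _).1 (hB i)) j) j'
  rw [Matrix.mul_apply] at h
  rw [Matrix.mul_apply, Fintype.sum_prod_type, Finset.sum_eq_single i]
  · by_cases hi : i = i'
    · subst hi
      simpa [Matrix.one_apply] using h
    · simp [hi, Ne.symm hi]
  · intro t _ ht
    simp [Ne.symm ht]
  · simp

lemma exists_patchGroup_mulVec_meanVec {k d : ℕ} {ws : EuclideanSpace ℝ (Fin d)} (hws : ‖ws‖ = 1)
    {u : Fin k → EuclideanSpace ℝ (Fin d)} (hu : ∀ t, ‖u t‖ = 1) :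
    ∃ U ∈ patchGroup k d, U ∈ Matrix.orthogonalGroup (Fin k × Fin d) ℝ ∧
      ∀ t, U *ᵥ meanVec ws t = meanVec (u t) t := by
  choose B hB hBu using fun t => exists_orthogonal_mulVec_eq (hws.trans (hu t).symm)
  refine ⟨_, Submonoid.subset_closure (Or.inl ⟨B, hB, rfl⟩),
    blockDiagonal_mem_orthogonalGroup hB, fun t => ?_⟩
  ext ⟨i, j⟩
  have h := congrFun (hBu t) j
  simp only [Matrix.mulVec, dotProduct] at h
  simp only [Matrix.mulVec, dotProduct, meanVec, Fintype.sum_prod_type, Matrix.of_apply]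
  rw [Finset.sum_eq_single t]
  · by_cases hi : i = t
    · subst hi
      simpa using h
    · simp [hi]
  · intro i' _ hi'
    simp [hi']
  · simp

lemma expectedRisk_signedMixture_eq {k d n : ℕ} [NeZero k] {σ : ℝ} (hσ : 0 < σ)
    {ws : EuclideanSpace ℝ (Fin d)} (hws : ‖ws‖ = 1)
    (A : IterAlgorithm (Fin k × Fin d) (ParamIdx k d) (lcnParams k d) n)
    (hA : A.IsEquivariant lcn (patchGroup k d))
    {u : Fin k → EuclideanSpace ℝ (Fin d)} (hu : ∀ t, ‖u t‖ = 1) :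
    expectedRisk A lcn (signedMixture (fun t => meanVec (u t) t) σ) =
      expectedRisk A lcn (DSD k d ws σ) := by
  obtain ⟨U, hU, hUo, hUm⟩ := exists_patchGroup_mulVec_meanVec hws hu
  rw [DSD_eq_signedMixture, ← expectedRisk_map_eq A hA hU hUo (signedMixture (fun t => meanVec ws t) σ),
    map_signedMixture_orthogonal hUo _ hσ, funext hUm]

/-! ### The lower bound -/

lemma le_expectedRisk_of_lt {k d n : ℕ} [NeZero k] [NeZero d] {σ : ℝ} (hσ : 0 < σ)
    {ws : EuclideanSpace ℝ (Fin d)} (hws : ‖ws‖ = 1)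
    (A : IterAlgorithm (Fin k × Fin d) (ParamIdx k d) (lcnParams k d) n)
    (hA : A.IsEquivariant lcn (patchGroup k d)) (hr : ReturnsUnitWeights A)
    (hn : (n : ℝ) < 1 / 10 * max (σ ^ 2 * k * d) k) :
    ENNReal.ofReal (1 / 40) ≤ expectedRisk A lcn (DSD k d ws σ) := by
  have hk : (0 : ℝ) < k := by exact_mod_cast Nat.pos_of_ne_zero (NeZero.ne k)
  have hd : (0 : ℝ) < d := by exact_mod_cast Nat.pos_of_ne_zero (NeZero.ne d)
  have := A.isProb_init
  set N : ℝ := (Fintype.card (Fin k × Fin d → Bool) : ℝ) with hN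
  have hN0 : 0 < N := by
    rw [hN]
    exact_mod_cast Fintype.card_pos
  -- If the maximum is `σ²kd`, use `1 - exp(-x) ≤ x`; if it is `k`, use `1 - exp(-x) ≤ 1`.
  have hκ : n * (1 - Real.exp (-1 / (2 * (σ ^ 2 * d)))) ≤ k / 10 := by
    have he0 := Real.exp_pos (-1 / (2 * (σ ^ 2 * d)))
    have he1 := Real.add_one_le_exp (-1 / (2 * (σ ^ 2 * d)))
    have hn0 : (0 : ℝ) ≤ n := Nat.cast_nonneg n
    rcases max_choice (σ ^ 2 * k * d) (k : ℝ) with h | h <;> rw [h] at hn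
    · have h1 : n * (1 - Real.exp (-1 / (2 * (σ ^ 2 * d)))) ≤
          (1 / 10 * (σ ^ 2 * k * d)) * (1 / (2 * (σ ^ 2 * d))) := by
        refine mul_le_mul hn.le ?_ ?_ (by positivity)
        · rw [neg_div] at he1
          rw [neg_div]
          linarith
        · rw [sub_nonneg, Real.exp_le_one_iff]
          exact div_nonpos_of_nonpos_of_nonneg (by norm_num) (by positivity)
      have h2 : (1 / 10 * (σ ^ 2 * k * d)) * (1 / (2 * (σ ^ 2 * d))) = k / 20 := by
        field_simp
        norm_num
      linarith
    · nlinarith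
  -- the affine lower bound of the risk, as a function of the initial point and the data
  set f : (Fin k × Fin d → Bool) → (ParamIdx k d → ℝ) →
      (Fin n → (Fin k × Fin d → ℝ) × ℝ) → ℝ := fun ε v S =>
    1 / 4 - (∑ t, patchCorr (A.output v S) t (signVec ε t)) / (2 * k) with hf
  have hout : Measurable fun q : (ParamIdx k d → ℝ) × (Fin n → (Fin k × Fin d → ℝ) × ℝ) =>
      A.output q.1 q.2 := A.measurable_iterate A.T le_rfl
  have hfm : ∀ ε, Measurable fun q : (ParamIdx k d → ℝ) × (Fin n → (Fin k × Fin d → ℝ) × ℝ) =>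
      f ε q.1 q.2 := by
    intro ε
    refine measurable_const.sub (Measurable.div_const (Finset.measurable_sum _ fun t _ =>
      Finset.measurable_sum _ fun j _ => Measurable.mul_const ?_ _) _)
    exact (measurable_pi_apply (Sum.inl (t, j))).comp hout
  have hgood : ∀ᵐ v ∂A.init, ∀ S, 0 ≤ bias (A.output v S) ∧ ∀ i, ‖weight (A.output v S) i‖ ≤ 1 := by
    filter_upwards [A.init_mem, hr] with v hv hrv S
    exact ⟨A.iterate_mem hv S A.T le_rfl, hrv S⟩
  set R := expectedRisk A lcn (DSD k d ws σ) with hR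
  have hlow : ∀ ε, ∫⁻ v, ∫⁻ S, ENNReal.ofReal (f ε v S)
      ∂(Measure.pi fun _ => signedMixture (signMean ε) σ) ∂A.init ≤ R := by
    intro ε
    rw [hR, ← expectedRisk_signedMixture_eq hσ hws A hA (u := signVec ε) (norm_signVec ε)]
    refine lintegral_mono_ae ?_
    filter_upwards [hgood] with v hv
    refine lintegral_mono fun S => ?_
    exact le_risk_signedMixture (hv S).1 (norm_signVec ε) (hv S).2 σ
  -- With the initial point fixed, the returned weights are a deterministic function of the data, to
  -- which the sign recovery bound applies; the initialization is averaged out afterwards.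
  have hfix : ∀ᵐ v ∂A.init, ENNReal.ofReal (N / 40) ≤ ∑ ε, ∫⁻ S, ENNReal.ofReal (f ε v S)
      ∂(Measure.pi fun _ => signedMixture (signMean ε) σ) := by
    filter_upwards [hgood] with v hv
    have hgm : ∀ p : Fin k × Fin d, Measurable fun S : Fin n → (Fin k × Fin d → ℝ) × ℝ =>
        A.output v S (Sum.inl p) := fun p =>
      (measurable_pi_apply _).comp (hout.comp measurable_prodMk_left)
    have hsq : ∀ S t, ∑ j, A.output v S (Sum.inl (t, j)) ^ 2 ≤ 1 := by
      intro S t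
      have h1 := (hv S).2 t
      rw [← sq_le_one_iff₀ (norm_nonneg _), EuclideanSpace.real_norm_sq_eq] at h1
      exact h1
    have hgi : ∀ ε p, Integrable (fun S => A.output v S (Sum.inl p))
        (Measure.pi fun _ : Fin n => signedMixture (signMean ε) σ) := fun ε p =>
      Integrable.of_bound (hgm p).aestronglyMeasurable 1 (Filter.Eventually.of_forall fun S => by
        rw [Real.norm_eq_abs, ← sq_le_one_iff_abs_le_one]
        exact (Finset.single_le_sum (f := fun j => A.output v S (Sum.inl (p.1, j)) ^ 2)
          (fun _ _ => sq_nonneg _) (Finset.mem_univ p.2)).trans (hsq S p.1))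
    have hfe : ∀ ε S, f ε v S = 1 / 4 - (2 * k * √d)⁻¹ *
        ∑ p, boolSign (ε p) * A.output v S (Sum.inl p) := by
      intro ε S
      simp only [hf, patchCorr, signVec, weight, Fintype.sum_prod_type, Finset.mul_sum,
        Finset.sum_div]
      congr 1
      refine Finset.sum_congr rfl fun t _ => Finset.sum_congr rfl fun j _ => ?_
      field_simp
    have hsi : ∀ ε, Integrable (fun S => ∑ p, boolSign (ε p) * A.output v S (Sum.inl p))
        (Measure.pi fun _ : Fin n => signedMixture (signMean ε) σ) := fun ε =>
      integrable_finsetSum _ fun p _ => (hgi ε p).const_mul _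
    have hint : ∀ ε, ∫ S, f ε v S ∂(Measure.pi fun _ => signedMixture (signMean ε) σ) =
        1 / 4 - (2 * k * √d)⁻¹ * ∑ p, boolSign (ε p) *
          ∫ S, A.output v S (Sum.inl p) ∂(Measure.pi fun _ => signedMixture (signMean ε) σ) := by
      intro ε
      simp_rw [hfe]
      rw [integral_sub (integrable_const _) ((hsi ε).const_mul _), integral_const_mul,
        integral_finsetSum _ fun p _ => (hgi ε p).const_mul _]
      simp [integral_const_mul]
    have hsd : 0 < √(d : ℝ) := Real.sqrt_pos.2 hd
    -- The scale `1/√d` of `l` is that of a typical weight entry. After division by `2k√d` the two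
    -- terms are at most `1/10` and exactly `1/8`, and `1/4 - 1/8 - 1/10 = 1/40`.
    have main := sum_integral_sign_le hσ n (g := fun S p => A.output v S (Sum.inl p)) hgm hsq
      (l := 4 / √d) (by positivity)
    have hsum : N / 40 ≤ ∑ ε, ∫ S, f ε v S ∂(Measure.pi fun _ => signedMixture (signMean ε) σ) := by
      simp_rw [hint]
      rw [Finset.sum_sub_distrib, ← Finset.mul_sum, Finset.sum_const, Finset.card_univ,
        nsmul_eq_mul, ← hN]
      have h1 := mul_le_mul_of_nonneg_left main (show 0 ≤ (2 * k * √(d : ℝ))⁻¹ by positivity)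
      have h2 : (2 * k * √(d : ℝ))⁻¹ * (N * (d * (4 / √d) *
          (n * (1 - Real.exp (-1 / (2 * (σ ^ 2 * d))))) / 2 + k / (4 / √d))) =
          N * (n * (1 - Real.exp (-1 / (2 * (σ ^ 2 * d)))) / k + 1 / 8) := by
        have h3 : (d : ℝ) = √d * √d := (Real.mul_self_sqrt hd.le).symm
        generalize (n * (1 - Real.exp (-1 / (2 * (σ ^ 2 * d)))) : ℝ) = r
        generalize √(d : ℝ) = s at *
        rw [h3]
        field_simp
        ring
      have h4 : n * (1 - Real.exp (-1 / (2 * (σ ^ 2 * d)))) / k ≤ 1 / 10 := by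
        rw [div_le_iff₀ hk]
        linarith
      rw [← hN, h2] at h1
      nlinarith
    have hfi : ∀ ε, Integrable (f ε v)
        (Measure.pi fun _ : Fin n => signedMixture (signMean ε) σ) := fun ε => by
      have : f ε v = fun S => 1 / 4 - (2 * k * √d)⁻¹ *
        ∑ p, boolSign (ε p) * A.output v S (Sum.inl p) := funext (hfe ε)
      rw [this]
      exact (integrable_const _).sub ((hsi ε).const_mul _)
    refine (ENNReal.ofReal_le_ofReal hsum).trans ((ofReal_sum_le _ _).trans ?_)
    refine Finset.sum_le_sum fun ε _ => ?_
    exact ofReal_integral_le_lintegral (hfi ε)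
  have hle : ENNReal.ofReal (N / 40) ≤ ENNReal.ofReal N * R := by
    calc ENNReal.ofReal (N / 40) = ∫⁻ _, ENNReal.ofReal (N / 40) ∂A.init := by simp
      _ ≤ ∫⁻ v, ∑ ε, ∫⁻ S, ENNReal.ofReal (f ε v S)
          ∂(Measure.pi fun _ => signedMixture (signMean ε) σ) ∂A.init := lintegral_mono_ae hfix
      _ = ∑ ε, ∫⁻ v, ∫⁻ S, ENNReal.ofReal (f ε v S)
          ∂(Measure.pi fun _ => signedMixture (signMean ε) σ) ∂A.init :=
        lintegral_finsetSum _ fun ε _ => (hfm ε).ennreal_ofReal.lintegral_prod_right'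
      _ ≤ ∑ _ε : Fin k × Fin d → Bool, R := Finset.sum_le_sum fun ε _ => hlow ε
      _ = ENNReal.ofReal N * R := by
        rw [Finset.sum_const, Finset.card_univ, nsmul_eq_mul, hN, ENNReal.ofReal_natCast]
  have h1 : ENNReal.ofReal (N / 40) = ENNReal.ofReal N * ENNReal.ofReal (1 / 40) := by
    rw [← ENNReal.ofReal_mul hN0.le]
    congr 1
    ring
  rw [h1] at hle
  exact (ENNReal.mul_le_mul_iff_right (ENNReal.ofReal_pos.2 hN0).ne' ENNReal.ofReal_ne_top).1 hle

lemma le_sampleComplexity {k d : ℕ} [NeZero k] [NeZero d] {σ : ℝ} (hσ : 0 < σ)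
    {ws : EuclideanSpace ℝ (Fin d)} (hws : ‖ws‖ = 1)
    (A : (n : ℕ) → IterAlgorithm (Fin k × Fin d) (ParamIdx k d) (lcnParams k d) n)
    (hA : ∀ n, (A n).IsEquivariant lcn (patchGroup k d)) (hr : ∀ n, ReturnsUnitWeights (A n))
    {δ : ℝ} (hδ : δ < 1 / 40) :
    ENNReal.ofReal (1 / 10 * max (σ ^ 2 * k * d) k) ≤
      (sampleComplexity A lcn (DSD k d ws σ) δ : ENNReal) := by
  have h : ((⌈1 / 10 * max (σ ^ 2 * k * d) (k : ℝ)⌉₊ : ℕ) : ℕ∞) ≤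
      sampleComplexity A lcn (DSD k d ws σ) δ := by
    refine le_iInf₂ fun n hn => ?_
    rw [Nat.cast_le, Nat.ceil_le]
    by_contra! hlt
    have := (le_expectedRisk_of_lt hσ hws (A n) (hA n) (hr n) hlt).trans hn
    rw [ENNReal.ofReal_le_ofReal_iff'] at this
    rcases this with h | h <;> linarith
  refine le_trans ?_ (ENat.toENNReal_le.2 h)
  rw [ENat.toENNReal_coe]
  exact ENNReal.ofReal_le_natCast.2 (Nat.le_ceil _)

end LCNLower

theorem mainTheorem3 :
    ∃ c : ℝ, 0 < c ∧ ∃ C : ℝ, 0 < C ∧ ∃ k₀ d₀ : ℕ, ∀ k d : ℕ, k₀ ≤ k → d₀ ≤ d →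
      ∀ σ : ℝ, 0 < σ → ∀ ws : EuclideanSpace ℝ (Fin d), ‖ws‖ = 1 →
      ∀ A : (n : ℕ) → LCNLower.IterAlgorithm (Fin k × Fin d) (LCNLower.ParamIdx k d)
          (LCNLower.lcnParams k d) n,
        (∀ n, (A n).IsEquivariant LCNLower.lcn (LCNLower.patchGroup k d)) →
        (∀ n, LCNLower.ReturnsUnitWeights (A n)) →
        ENNReal.ofReal (c * max (σ ^ 2 * k * d) k) ≤
            (LCNLower.sampleComplexity A LCNLower.lcn (LCNLower.DSD k d ws σ)
              (0.25 * 10 ^ (-2 : ℤ)) : ENNReal) ∧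
          (C ≤ σ ^ 2 * d →
            ENNReal.ofReal (max (c * (σ ^ 2 * k * d)) (40 * k)) ≤
              (LCNLower.sampleComplexity A LCNLower.lcn (LCNLower.DSD k d ws σ)
                (0.25 * 10 ^ (-2 : ℤ)) : ENNReal)) := by
  -- The value `400` makes `σ²kd/10 ≥ 40k`. The thresholds `1` only ensure that there is a patch and
  -- a coordinate.
  refine ⟨1 / 10, by norm_num, 400, by norm_num, 1, 1, ?_⟩
  intro k d hk hd σ hσ ws hws A hA hr
  have : NeZero k := ⟨by omega⟩
  have : NeZero d := ⟨by omega⟩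
  have h := LCNLower.le_sampleComplexity hσ hws A hA hr
    (δ := 0.25 * 10 ^ (-2 : ℤ)) (by norm_num)
  refine ⟨h, fun hC => le_trans (ENNReal.ofReal_le_ofReal ?_) h⟩
  have hk0 : (0 : ℝ) ≤ k := Nat.cast_nonneg k
  have h1 : 1 / 10 * (σ ^ 2 * k * d) ≤ 1 / 10 * max (σ ^ 2 * k * d) (k : ℝ) :=
    mul_le_mul_of_nonneg_left (le_max_left _ _) (by norm_num)
  refine max_le h1 (le_trans ?_ h1)
  nlinarith
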